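/- **Setting.** Let $n\ge 1$ and let $K:[0,1]\to[0,\infty)$ be continuous with $\int_0^1K(r)\,dr=1$. For $N\ge 2$ particles $Z_i=(x_i,v_i)\in\mathbb R^n\times\mathbb R^n$ and $i\in\{1,\dots,N\}$, number the particles $j\ne i$ by $R^N(i,j)\in\{1,\dots,N-1\}$ in order of increasing distance $|x_j-x_i|$ (ties are broken arbitrarily), and put $$\pi^N_{ij}(\mathbf x)=\frac{K\big(R^N(i,j)/(N-1)\big)}{\sum_{k=1}^{N-1}K\big(k/(N-1)\big)}\qquad(j\neq i).$$ The particles fly freely ($\dot x_i=v_i$, $\dot v_i=0$), and at rate $N$ a uniformly chosen particle $i$ adopts the velocity $v_j$ of a particle $j\ne i$ chosen with probability $\pi^N_{ij}(\mathbf x)$. The master equation for the $N$-particle density $f^{(N)}(\mathbf Z,t)$, tested against an observable $\Phi$, is, for all $t\ge0$ (with a one-sided derivative at $t=0$), $$\frac{d}{dt}\int f^{(N)}\Phi\,d\mathbf Z=\sum_{i=1}^N\int f^{(N)}\,v_i\cdot\nabla_{x_i}\Phi\,d\mathbf Z+N\int\Big[\frac1N\sum_{i\ne j}\pi^N_{ij}(\mathbf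 x)\,\Phi(Z_1,\dots,(x_i,v_j),\dots,Z_N)-\Phi(\mathbf Z)\Big]f^{(N)}\,d\mathbf Z .$$ Let $f^{(1)}_N(Z_1,t)=\int f^{(N)}\,dZ_2\cdots dZ_N$ and $\rho^{(1)}_N(x,t)=\int f^{(1)}_N(x,v,t)\,dv$. **Assumptions.** For all sufficiently large $N$, $f^{(N)}(\cdot,t)$ is a probability density for every $t\ge0$, the master equation holds for every one-particle observable $\Phi(\mathbf Z)=\phi(Z_1)$ with $\phi\in C_c^\infty(\mathbb R^{2n})$, and propagation of chaos holds: $$f^{(N)}(Z_1,\dots,Z_N,t)=\prod_{\ell=1}^N f^{(1)}_N(Z_\ell,t)\quad\text{for all }t\ge0\text{ and almost every }\mathbf Z.$$ Moreover $f(\cdot,t)\in L^1(\mathbb R^{2n})$, and for every $t\ge0$, as $N\to\infty$, $f^{(1)}_N(\cdot,t)\to f(\cdot,t)$ tested against continuous compactly supported functions, and $\rho^{(1)}_N(\cdot,t)\to\rho(\cdot,t)=\int f(\cdot,v,t)\,dv$ tested against bounded continuous functions. **Conclusion.** Let $M_\rho(x,s)=\int_{|x'-x|\le s}\rho(x')\,dx'$,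 where $\rho=\rho(\cdot,t)$. Then for every $\phi\in C^\infty_c(\mathbb R^{2n})$ and every $t\ge0$ (with a one-sided derivative at $t=0$) $$\frac{d}{dt}\int f\,\phi\,dZ=\int f\,v\cdot\nabla_x\phi\,dZ+\int \phi(x_1,v_2)\,f(x_2,v_2,t)\,\rho(x_1,t)\,K\big(M_\rho(x_1,|x_2-x_1|)\big)\,dx_1\,dx_2\,dv_2-\int f\,\phi\,dZ ,$$ where the integrand of the second integral on the right is integrable. If in addition $f$ is continuously differentiable in $(x,v,t)$ for $t>0$, then for every $t>0$ and almost every $(x,v)$ $$\partial_tf+v\cdot\nabla_xf=\rho(x,t)\int f(x',v,t)\,K\big(M_\rho(x,|x'-x|)\big)\,dx'-f(x,v,t).$$ -/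

import Mathlib

open MeasureTheory Filter Topology
open scoped ContDiff

namespace ChooseLeader

noncomputable section

/-- Positions (and velocities) live in `ℝⁿ` with its Euclidean norm. -/
abbrev Space (n : ℕ) := EuclideanSpace ℝ (Fin n)

/-- A one-particle state `Z = (x, v)`. -/
abbrev Phase (n : ℕ) := Space n × Space n

/-! ### The `N`-particle dynamics, with `N = M + 1` -/

/-- `R i j` is a proximity rank of particle `j` with respect to particle `i`: for each `i`, the
other particles are numbered `1, …, M` by increasing distance to `i`, particles at equal distance
being ordered arbitrarily; and `R i i = 0`. -/
structure IsRanking {n M : ℕ} (x : Fin (M + 1) → Space n)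
    (R : Fin (M + 1) → Fin (M + 1) → ℕ) : Prop where
  self : ∀ i, R i i = 0
  bijOn : ∀ i, Set.BijOn (R i) {j | j ≠ i} (Set.Icc 1 M)
  lt_of_dist_lt : ∀ i j k, j ≠ i → k ≠ i → dist (x j) (x i) < dist (x k) (x i) → R i j < R i k

/-- Probability that a follower chooses the leader of rank number `r ∈ {1, …, M}`:
`K (r / M) / ∑ₖ K (k / M)`. -/
def leaderProb (K : ℝ → ℝ) (M r : ℕ) : ℝ :=
  K ((r : ℝ) / M) / ∑ k ∈ Finset.Icc 1 M, K ((k : ℝ) / M)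

/-- Particle `i` adopts the velocity of particle `j`. -/
def collide {n M : ℕ} (i j : Fin (M + 1)) (Z : Fin (M + 1) → Phase n) : Fin (M + 1) → Phase n :=
  Function.update Z i ((Z i).1, (Z j).2)

/-- `(vᵢ · ∇_{xᵢ}) Φ`. -/
def transportAt {n M : ℕ} (i : Fin (M + 1)) (Φ : (Fin (M + 1) → Phase n) → ℝ)
    (Z : Fin (M + 1) → Phase n) : ℝ :=
  fderiv ℝ (fun y : Space n => Φ (Function.update Z i (y, (Z i).2))) (Z i).1 (Z i).2

/-- The master equation in weak form for the time-dependent `N`-particle density `F`, tested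
against the observable `Φ`. Collisions occur at rate `N = M + 1`; the follower `i` is uniform and
its leader `j ≠ i` is chosen with probability `leaderProb K M (R x i j)`. At `t = 0` the time
derivative is one-sided. -/
def MasterEquation {n M : ℕ} (K : ℝ → ℝ)
    (R : (Fin (M + 1) → Space n) → Fin (M + 1) → Fin (M + 1) → ℕ)
    (F : ℝ → (Fin (M + 1) → Phase n) → ℝ) (Φ : (Fin (M + 1) → Phase n) → ℝ) : Prop :=
  ∀ t : ℝ, 0 ≤ t →
    HasDerivWithinAt (fun s => ∫ Z, F s Z * Φ Z)
      ((∑ i, ∫ Z, F t Z * transportAt i Φ Z) +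
        ((M : ℝ) + 1) * ∫ Z, (1 / ((M : ℝ) + 1) *
            (∑ i, ∑ j ∈ Finset.univ.erase i,
              leaderProb K M (R (fun l => (Z l).1) i j) * Φ (collide i j Z)) - Φ Z) * F t Z)
      (Set.Ici 0) t

/-- `g` is a probability density. -/
def IsProbDensity {α : Type*} [MeasureSpace α] (g : α → ℝ) : Prop :=
  (∀ᵐ z, 0 ≤ g z) ∧ Integrable g ∧ ∫ z, g z = 1

/-- The first marginal `f⁽¹⁾(Z₁) = ∫ f⁽ᴺ⁾(Z₁, Z₂, …, Z_N) dZ₂ ⋯ dZ_N`. -/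
def firstMarginal {n M : ℕ} (F : (Fin (M + 1) → Phase n) → ℝ) (Z₁ : Phase n) : ℝ :=
  ∫ W : Fin M → Phase n, F (Fin.cons Z₁ W)

/-- The `N`-particle density is the product of its first marginals. -/
def IsChaotic {n M : ℕ} (F : (Fin (M + 1) → Phase n) → ℝ) : Prop :=
  ∀ᵐ Z, F Z = ∏ l, firstMarginal F (Z l)

/-! ### The limit equation -/

/-- The spatial density `ρ(x) = ∫ f(x, v) dv`. -/
def spatialDensity {n : ℕ} (f : Phase n → ℝ) (x : Space n) : ℝ :=
  ∫ v : Space n, f (x, v)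

/-- The partial mass `M_ρ(x, s)`: the mass of `ρ` in the closed ball of centre `x`, radius `s`. -/
def partialMass {n : ℕ} (ρ : Space n → ℝ) (x : Space n) (s : ℝ) : ℝ :=
  ∫ x' in Metric.closedBall x s, ρ x'

/-- `v · ∇ₓ φ`. -/
def transport {n : ℕ} (φ : Phase n → ℝ) (z : Phase n) : ℝ :=
  fderiv ℝ (fun y : Space n => φ (y, z.2)) z.1 z.2

/-- The integrand `φ(x₁, v₂) f(x₂, v₂) ρ(x₁) K(M_ρ(x₁, |x₂ - x₁|))` of the weak gain term, as a
function of `w = (x₁, (x₂, v₂))`. -/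
def gainIntegrand {n : ℕ} (K : ℝ → ℝ) (f φ : Phase n → ℝ) (w : Space n × Phase n) : ℝ :=
  φ (w.1, w.2.2) * f w.2 * spatialDensity f w.1 *
    K (partialMass (spatialDensity f) w.1 ‖w.2.1 - w.1‖)

/-- The gain term in strong form: `ρ(x) ∫ f(x', v) K(M_ρ(x, |x' - x|)) dx'`. -/
def gain {n : ℕ} (K : ℝ → ℝ) (f : Phase n → ℝ) (z : Phase n) : ℝ :=
  spatialDensity f z.1 *
    ∫ x' : Space n, f (x', z.2) * K (partialMass (spatialDensity f) z.1 ‖x' - z.1‖)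

end

end ChooseLeader

open ChooseLeader

/-! In a chaotic state the particles are independent with common law `ν`, the law of the first
marginal. For an observable of particle `0` alone, every collision with another follower leaves the
observable unchanged. The rate `N` therefore cancels the factor `1/N`, and the collision term
becomes `∫ leaderMean - ∫ φ`.

The rank of particle `j` seen from particle `0` is almost surely the number of particles at most as
far away as `j`, since a law with a density gives no mass to spheres and so allows no ties. Given `Z
0` and `Z j`, this is a sum of independent indicators with mean `ballMass`, apart from the one term
`k = j`. Its variance is of order `M`, so rank divided by `M` is close to the partial mass
(`integral_abs_comp_closerCount_sub_le`). The normalising sum is a Riemann sum, asymptotic to `M`.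
Hence the collision gain is close to `meanGain K φ ν`, with an explicit error
(`abs_integral_leader_sub_le`).

It remains to let `N → ∞`. Convergence of the spatial densities tested against `1` prevents loss of
mass, so the limit is a probability density and the laws converge weakly. At a law that does not
charge spheres, ball masses are jointly continuous in law, centre and radius, and `meanGain` is
therefore continuous there (`tendsto_meanGain`). The time derivatives are bounded uniformly in `N`,
so the limit law is weakly continuous in time, the limiting right-hand side is continuous, and the
integrated equation can be differentiated (`hasDerivWithinAt_of_tendsto`).

For regular `f`, differentiation under the integral, integration by parts in `x` and the fundamental
lemma of the calculus of variations give the strong form. -/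

namespace ChooseLeader

/-! ### Weak convergence of probability measures -/

section Weak

variable {E : Type*} [NormedAddCommGroup E] [NormedSpace ℝ E] [FiniteDimensional ℝ E]
  [MeasurableSpace E] [BorelSpace E]

/-- Tightness of one law, phrased with a continuous function so that convergence of `∫ χ` transfers
it to all late laws of a convergent family. -/
lemma exists_cutoff (μ : Measure E) [IsProbabilityMeasure μ] {ε : ℝ} (hε : 0 < ε) :
    ∃ χ : E → ℝ, Continuous χ ∧ HasCompactSupport χ ∧ (∀ x, 0 ≤ χ x) ∧ (∀ x, χ x ≤ 1) ∧
      1 - ε < ∫ x, χ x ∂μ := by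
  have : ProperSpace E := FiniteDimensional.proper_real E
  let χ : ℕ → E → ℝ := fun k x => max 0 (min 1 ((k : ℝ) + 1 - ‖x‖))
  have hc : ∀ k, Continuous (χ k) := fun k => by fun_prop
  have h0 : ∀ k x, 0 ≤ χ k x := fun k x => le_max_left _ _
  have h1 : ∀ k x, χ k x ≤ 1 := fun k x => max_le zero_le_one (min_le_left _ _)
  have hs : ∀ k, HasCompactSupport (χ k) := by
    intro k
    refine HasCompactSupport.intro (isCompact_closedBall (0 : E) ((k : ℝ) + 1)) fun x hx => ?_
    rw [mem_closedBall_zero_iff, not_le] at hx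
    exact max_eq_left ((min_le_right _ _).trans (by linarith))
  have hlim : Tendsto (fun k => ∫ x, χ k x ∂μ) atTop (𝓝 (∫ _, (1 : ℝ) ∂μ)) := by
    refine tendsto_integral_of_dominated_convergence (fun _ => (1 : ℝ))
      (fun k => (hc k).aestronglyMeasurable) (integrable_const _) (fun k => ?_) ?_
    · exact ae_of_all _ fun x => by rw [Real.norm_of_nonneg (h0 k x)]; exact h1 k x
    · refine ae_of_all _ fun x => tendsto_const_nhds.congr' ?_
      obtain ⟨m, hm⟩ := exists_nat_ge ‖x‖
      filter_upwards [eventually_ge_atTop m] with k hk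
      have : (m : ℝ) ≤ k := by exact_mod_cast hk
      change 1 = max 0 (min 1 ((k : ℝ) + 1 - ‖x‖))
      rw [min_eq_left (by linarith), max_eq_right zero_le_one]
  simp only [integral_const, probReal_univ, smul_eq_mul, mul_one] at hlim
  obtain ⟨k, hk⟩ := (hlim.eventually (lt_mem_nhds (sub_lt_self 1 hε))).exists
  exact ⟨χ k, hc k, hs k, h0 k, h1 k, hk⟩

variable {ι : Type*} {l : Filter ι} {μs : ι → ProbabilityMeasure E} {μ : ProbabilityMeasure E}

lemma integrable_of_bounded {α : Type*} [MeasurableSpace α] (μ : Measure α) [IsFiniteMeasure μ]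
    {g : α → ℝ} (hg : AEStronglyMeasurable g μ) {C : ℝ} (hC : ∀ x, |g x| ≤ C) : Integrable g μ :=
  Integrable.of_bound hg C (ae_of_all _ hC)

lemma abs_integral_sub_le {α : Type*} [MeasurableSpace α] (μ : Measure α) [IsFiniteMeasure μ]
    {g h b : α → ℝ} (hg : Integrable g μ) (hh : Integrable h μ) (hb : Integrable b μ)
    (hgh : ∀ x, |g x - h x| ≤ b x) : |∫ x, g x ∂μ - ∫ x, h x ∂μ| ≤ ∫ x, b x ∂μ := by
  rw [← integral_sub hg hh]
  exact (norm_integral_le_integral_norm _).trans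
    (integral_mono (hg.sub hh).norm hb fun x => hgh x)

/-- Bounded, locally uniformly convergent integrands against weakly convergent measures. -/
lemma tendsto_integral_of_tendstoLocallyUniformly (hμ : Tendsto μs l (𝓝 μ))
    {hs : ι → E → ℝ} {h : E → ℝ} {C : ℝ}
    (hmeas : ∀ i, AEStronglyMeasurable (hs i) (μs i : Measure E))
    (hsC : ∀ i x, |hs i x| ≤ C) (hcont : Continuous h) (hC : ∀ x, |h x| ≤ C)
    (hlim : TendstoLocallyUniformly hs h l) :
    Tendsto (fun i => ∫ x, hs i x ∂(μs i : Measure E)) l (𝓝 (∫ x, h x ∂(μ : Measure E))) := by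
  have hC0 : 0 ≤ C := (abs_nonneg _).trans (hC 0)
  rw [ProbabilityMeasure.tendsto_iff_forall_integral_tendsto] at hμ
  -- Both integrands are compared under the same moving law; the fixed `h` is then left to weak
  -- convergence.
  have key : Tendsto (fun i => ∫ x, hs i x ∂(μs i : Measure E) - ∫ x, h x ∂(μs i : Measure E)) l
      (𝓝 0) := by
    rw [Metric.tendsto_nhds]
    intro ε hε
    set δ : ℝ := ε / (2 * (2 * C + 1)) with hδ
    have hδ0 : 0 < δ := by positivity
    obtain ⟨χ, χc, χs, χ0, χ1, hχ⟩ := exists_cutoff (μ : Measure E) hδ0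
    have hχb : ∀ x, |χ x| ≤ 1 := fun x => by rw [abs_of_nonneg (χ0 x)]; exact χ1 x
    have hunif : TendstoUniformlyOn hs h l (tsupport χ) :=
      (tendstoLocallyUniformlyOn_iff_tendstoUniformlyOn_of_compact χs.isCompact).1
        hlim.tendstoLocallyUniformlyOn
    rw [Metric.tendstoUniformlyOn_iff] at hunif
    have hχlim := hμ (BoundedContinuousFunction.ofNormedAddCommGroup χ χc 1 hχb)
    simp only [BoundedContinuousFunction.coe_ofNormedAddCommGroup] at hχlim
    filter_upwards [hunif (ε / 4) (by positivity), hχlim.eventually (lt_mem_nhds hχ)] with i hi hi'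
    have hint : Integrable χ (μs i : Measure E) :=
      integrable_of_bounded _ χc.aestronglyMeasurable hχb
    have hint' : Integrable (fun x => 1 - χ x) (μs i : Measure E) := (integrable_const _).sub hint
    -- A bound for `|hs i - h|` everywhere: uniform convergence gives `ε / 4` on the support of `χ`,
    -- and off it `χ = 0` leaves the trivial bound `2 * C`.
    have hb : Integrable (fun x => ε / 4 + 2 * C * (1 - χ x)) (μs i : Measure E) :=
      (integrable_const _).add (hint'.const_mul _)
    have := abs_integral_sub_le (μs i : Measure E) (integrable_of_bounded _ (hmeas i) (hsC i))
      (integrable_of_bounded _ hcont.aestronglyMeasurable hC) hb fun x => by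
        by_cases hx : x ∈ tsupport χ
        · have h1 := hi x hx
          rw [dist_comm, Real.dist_eq] at h1
          have : 0 ≤ 2 * C * (1 - χ x) := mul_nonneg (by positivity) (by linarith [χ1 x])
          linarith
        · have h1 : χ x = 0 := image_eq_zero_of_notMem_tsupport hx
          have h2 := abs_sub (hs i x) (h x)
          rw [h1]
          linarith [hsC i x, hC x]
    rw [integral_add (integrable_const _) (hint'.const_mul _),
      integral_const_mul, integral_sub (integrable_const _) hint] at this
    simp only [integral_const, probReal_univ, smul_eq_mul, one_mul] at this
    rw [Real.dist_eq, sub_zero]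
    have h3 : 2 * C * (1 - ∫ x, χ x ∂(μs i : Measure E)) ≤ 2 * C * δ :=
      mul_le_mul_of_nonneg_left (by linarith) (by positivity)
    have h4 : 2 * C * δ ≤ ε / 2 := by
      rw [hδ, mul_div_assoc', div_le_div_iff₀ (by positivity) (by positivity)]
      nlinarith
    linarith
  have := key.add (hμ (BoundedContinuousFunction.ofNormedAddCommGroup h hcont C hC))
  simpa using this

/-- The limit is itself a probability measure, so no mass escapes and vague convergence is already
weak. Smooth test functions suffice by uniform approximation. -/
lemma tendsto_of_forall_integral_contDiff
    (H : ∀ φ : E → ℝ, ContDiff ℝ ∞ φ → HasCompactSupport φ →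
      Tendsto (fun i => ∫ x, φ x ∂(μs i : Measure E)) l (𝓝 (∫ x, φ x ∂(μ : Measure E)))) :
    Tendsto μs l (𝓝 μ) := by
  have Hc : ∀ ψ : E → ℝ, Continuous ψ → HasCompactSupport ψ →
      Tendsto (fun i => ∫ x, ψ x ∂(μs i : Measure E)) l (𝓝 (∫ x, ψ x ∂(μ : Measure E))) := by
    intro ψ ψc ψs
    rw [Metric.tendsto_nhds]
    intro ε hε
    obtain ⟨φ, hφ, hd, hsub⟩ := ψc.exists_contDiff_approx ⊤ (ε := fun _ => ε / 4)
      continuous_const (fun _ => by positivity)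
    have φs : HasCompactSupport φ := ψs.mono hsub
    have hbd : ∀ ν : ProbabilityMeasure E,
        |∫ x, φ x ∂(ν : Measure E) - ∫ x, ψ x ∂(ν : Measure E)| ≤ ε / 4 := by
      intro ν
      have := abs_integral_sub_le (ν : Measure E)
        (hφ.continuous.integrable_of_hasCompactSupport φs)
        (ψc.integrable_of_hasCompactSupport ψs) (integrable_const (ε / 4)) fun x => by
          have := (hd x).le; rwa [Real.dist_eq] at this
      simpa using this
    filter_upwards [Metric.tendsto_nhds.1 (H φ hφ φs) (ε / 4) (by positivity)] with i hi
    rw [Real.dist_eq] at hi ⊢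
    have h1 := hbd (μs i)
    have h2 := hbd μ
    rw [abs_lt] at hi ⊢
    rw [abs_le] at h1 h2
    constructor <;> linarith
  rw [ProbabilityMeasure.tendsto_iff_forall_integral_tendsto]
  intro ψ
  rw [Metric.tendsto_nhds]
  intro ε hε
  set C := ‖ψ‖ with hC
  have hC0 : 0 ≤ C := norm_nonneg _
  have hψC : ∀ x, |ψ x| ≤ C := fun x => ψ.norm_coe_le_norm x
  set δ : ℝ := ε / (4 * (C + 1)) with hδ
  have hδ0 : 0 < δ := by positivity
  obtain ⟨χ, χc, χs, χ0, χ1, hχ⟩ := exists_cutoff (μ : Measure E) hδ0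
  have hχb : ∀ x, |χ x| ≤ 1 := fun x => by rw [abs_of_nonneg (χ0 x)]; exact χ1 x
  have hCδ : C * δ ≤ ε / 4 := by
    rw [hδ, mul_div_assoc', div_le_div_iff₀ (by positivity) (by positivity)]
    nlinarith
  -- The truncation error depends only on the mass captured by `χ`, so one estimate serves both `μs
  -- i` and `μ`.
  have hbd : ∀ ν : ProbabilityMeasure E, 1 - δ < ∫ x, χ x ∂(ν : Measure E) →
      |∫ x, ψ x ∂(ν : Measure E) - ∫ x, ψ x * χ x ∂(ν : Measure E)| ≤ ε / 4 := by
    intro ν hν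
    have hint : Integrable χ (ν : Measure E) :=
      integrable_of_bounded _ χc.aestronglyMeasurable hχb
    have hint' : Integrable (fun x => 1 - χ x) (ν : Measure E) := (integrable_const _).sub hint
    have hint2 : Integrable (fun x => ψ x * χ x) (ν : Measure E) :=
      (ψ.continuous.mul χc).integrable_of_hasCompactSupport χs.mul_left
    have := abs_integral_sub_le (ν : Measure E) (ψ.integrable _) hint2
      (hint'.const_mul C) fun x => by
        have : ψ x - ψ x * χ x = ψ x * (1 - χ x) := by ring
        rw [this, abs_mul, abs_of_nonneg (by linarith [χ1 x] : 0 ≤ 1 - χ x)]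
        exact mul_le_mul_of_nonneg_right (hψC x) (by linarith [χ1 x])
    rw [integral_const_mul, integral_sub (integrable_const _) hint] at this
    simp only [integral_const, probReal_univ, smul_eq_mul, one_mul] at this
    have h3 : C * (1 - ∫ x, χ x ∂(ν : Measure E)) ≤ C * δ :=
      mul_le_mul_of_nonneg_left (by linarith) hC0
    linarith
  filter_upwards [(Hc χ χc χs).eventually (lt_mem_nhds hχ),
    Metric.tendsto_nhds.1 (Hc (fun x => ψ x * χ x) (ψ.continuous.mul χc) χs.mul_left) (ε / 4)
      (by positivity)] with i hi hi'
  have h1 := hbd (μs i) hi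
  have h2 := hbd μ hχ
  rw [Real.dist_eq] at hi' ⊢
  rw [abs_lt] at hi' ⊢
  rw [abs_le] at h1 h2
  constructor <;> linarith

end Weak

/-! ### Ball masses under weak convergence -/

section Balls

variable {E : Type*} [NormedAddCommGroup E] [MeasurableSpace E] [BorelSpace E]
  {ι : Type*} {l : Filter ι} {μs : ι → ProbabilityMeasure E} {μ : ProbabilityMeasure E}

/-- The masses of balls depend jointly continuously on the measure, the centre and the radius, at
measures which do not charge spheres. -/
lemma tendsto_measureReal_closedBall (hμ : Tendsto μs l (𝓝 μ))
    (hsph : ∀ (x : E) (s : ℝ), (μ : Measure E) (Metric.sphere x s) = 0) (x₀ : E) (s₀ : ℝ) :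
    Tendsto (fun p : ι × (E × ℝ) =>
        (μs p.1 : Measure E).real (Metric.closedBall p.2.1 p.2.2)) (l ×ˢ 𝓝 (x₀, s₀))
      (𝓝 ((μ : Measure E).real (Metric.closedBall x₀ s₀))) := by
  have hfix : ∀ s, Tendsto (fun i => (μs i : Measure E).real (Metric.closedBall x₀ s)) l
      (𝓝 ((μ : Measure E).real (Metric.closedBall x₀ s))) := by
    intro s
    have hfr : (μ : Measure E) (frontier (Metric.closedBall x₀ s)) = 0 :=
      measure_mono_null Metric.frontier_closedBall_subset_sphere (hsph x₀ s)
    exact (ENNReal.tendsto_toReal (measure_ne_top _ _)).comp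
      (ProbabilityMeasure.tendsto_measure_of_null_frontier_of_tendsto' hμ hfr)
  have hright : Tendsto (fun s => (μ : Measure E).real (Metric.closedBall x₀ s)) (𝓝[>] s₀)
      (𝓝 ((μ : Measure E).real (Metric.closedBall x₀ s₀))) := by
    have := tendsto_measure_biInter_gt (μ := (μ : Measure E))
      (s := fun s => Metric.closedBall x₀ s) (a := s₀)
      (fun r _ => Metric.isClosed_closedBall.measurableSet.nullMeasurableSet)
      (fun i j _ hij => Metric.closedBall_subset_closedBall hij)
      ⟨s₀ + 1, by simp, measure_ne_top _ _⟩
    have he : ⋂ r > s₀, Metric.closedBall x₀ r = Metric.closedBall x₀ s₀ := by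
      ext y
      simp only [Set.mem_iInter, Metric.mem_closedBall]
      exact ⟨fun h => le_of_forall_gt_imp_ge_of_dense h, fun h r hr => h.trans hr.le⟩
    rw [he] at this
    exact (ENNReal.tendsto_toReal (measure_ne_top _ _)).comp this
  have hleft : Tendsto (fun k : ℕ => (μ : Measure E).real (Metric.closedBall x₀ (s₀ - 1 / (k + 1))))
      atTop (𝓝 ((μ : Measure E).real (Metric.closedBall x₀ s₀))) := by
    have := tendsto_measure_iUnion_atTop (μ := (μ : Measure E))
      (s := fun k : ℕ => Metric.closedBall x₀ (s₀ - 1 / (k + 1)))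
      (fun i j hij => Metric.closedBall_subset_closedBall
        (sub_le_sub_left (Nat.one_div_le_one_div hij) _))
    have he : ⋃ k : ℕ, Metric.closedBall x₀ (s₀ - 1 / (k + 1)) = Metric.ball x₀ s₀ := by
      ext y
      simp only [Set.mem_iUnion, Metric.mem_closedBall, Metric.mem_ball]
      refine ⟨fun ⟨k, hk⟩ => ?_, fun h => ?_⟩
      · have : (0 : ℝ) < 1 / (k + 1) := Nat.one_div_pos_of_nat
        linarith
      · obtain ⟨k, hk⟩ := exists_nat_one_div_lt (sub_pos.2 h)
        exact ⟨k, by linarith⟩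
    -- Continuity from the left in the radius is where null spheres matter; continuity from the
    -- right holds for any finite measure.
    have he' : (μ : Measure E) (Metric.ball x₀ s₀) = (μ : Measure E) (Metric.closedBall x₀ s₀) := by
      refine le_antisymm (measure_mono Metric.ball_subset_closedBall) ?_
      rw [← Metric.ball_union_sphere]
      exact (measure_union_le _ _).trans (by rw [hsph, add_zero])
    rw [he, he'] at this
    exact (ENNReal.tendsto_toReal (measure_ne_top _ _)).comp this
  rw [Metric.tendsto_nhds]
  intro ε hε
  -- Every ball with centre near `x₀` and radius near `s₀` is sandwiched between balls about `x₀` of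
  -- fixed radii `a < s₀ < b`, for which the portmanteau theorem applies.
  obtain ⟨a, ha, ha'⟩ : ∃ a, (μ : Measure E).real (Metric.closedBall x₀ s₀) - ε <
      (μ : Measure E).real (Metric.closedBall x₀ a) ∧ a < s₀ := by
    obtain ⟨k, hk⟩ := (hleft.eventually (lt_mem_nhds (sub_lt_self _ hε))).exists
    exact ⟨_, hk, sub_lt_self _ Nat.one_div_pos_of_nat⟩
  obtain ⟨b, hb, hb'⟩ := ((hright.eventually (gt_mem_nhds (lt_add_of_pos_right _ hε))).and
    self_mem_nhdsWithin).exists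
  have h1 := (hfix a).eventually (lt_mem_nhds ha)
  have h2 := (hfix b).eventually (gt_mem_nhds hb)
  have h3 : ∀ᶠ q : E × ℝ in 𝓝 (x₀, s₀), dist q.1 x₀ + q.2 < b := by
    have : Tendsto (fun q : E × ℝ => dist q.1 x₀ + q.2) (𝓝 (x₀, s₀)) (𝓝 (dist x₀ x₀ + s₀)) :=
      Continuous.tendsto (by fun_prop) _
    rw [dist_self, zero_add] at this
    exact this.eventually (gt_mem_nhds hb')
  have h4 : ∀ᶠ q : E × ℝ in 𝓝 (x₀, s₀), a < q.2 - dist q.1 x₀ := by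
    have : Tendsto (fun q : E × ℝ => q.2 - dist q.1 x₀) (𝓝 (x₀, s₀)) (𝓝 (s₀ - dist x₀ x₀)) :=
      Continuous.tendsto (by fun_prop) _
    rw [dist_self, sub_zero] at this
    exact this.eventually (lt_mem_nhds ha')
  filter_upwards [(h1.and h2).prod_mk (h3.and h4)] with p hp
  obtain ⟨⟨p1, p2⟩, p3, p4⟩ := hp
  have m1 : (μs p.1 : Measure E).real (Metric.closedBall x₀ a) ≤
      (μs p.1 : Measure E).real (Metric.closedBall p.2.1 p.2.2) :=
    measureReal_mono (Metric.closedBall_subset_closedBall' (by rw [dist_comm]; linarith))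
  have m2 : (μs p.1 : Measure E).real (Metric.closedBall p.2.1 p.2.2) ≤
      (μs p.1 : Measure E).real (Metric.closedBall x₀ b) :=
    measureReal_mono (Metric.closedBall_subset_closedBall' (by linarith))
  rw [Real.dist_eq, abs_lt]
  constructor <;> linarith

lemma continuous_measureReal_closedBall
    (hsph : ∀ (x : E) (s : ℝ), (μ : Measure E) (Metric.sphere x s) = 0) :
    Continuous fun q : E × ℝ => (μ : Measure E).real (Metric.closedBall q.1 q.2) := by
  rw [continuous_iff_continuousAt]
  rintro ⟨x, s⟩
  -- A constant family turns joint convergence into continuity in centre and radius.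
  have := tendsto_measureReal_closedBall (l := pure ()) (μs := fun _ : Unit => μ)
    tendsto_const_nhds hsph x s
  rw [pure_prod] at this
  simpa [ContinuousAt, tendsto_map'_iff, Function.comp_def] using this

end Balls

end ChooseLeader

namespace ChooseLeader

/-! ### The gain functional -/

/-- The mass, with respect to the spatial marginal of `ν`, of a closed ball. -/
noncomputable def ballMass {n : ℕ} (ν : ProbabilityMeasure (Phase n)) (x : Space n) (s : ℝ) : ℝ :=
  (ν : Measure (Phase n)).real (Prod.fst ⁻¹' Metric.closedBall x s)

/-- The spatial marginal of `ν` does not charge spheres. -/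
def NullSpheres {n : ℕ} (ν : ProbabilityMeasure (Phase n)) : Prop :=
  ∀ (x : Space n) (s : ℝ), (ν : Measure (Phase n)) (Prod.fst ⁻¹' Metric.sphere x s) = 0

/-- The weak gain term as a functional of the one-particle law: the function
`φ(x₁, v₂) K(M(x₁, |x₂ - x₁|))` of two particles. -/
noncomputable def gainObservable {n : ℕ} (K : ℝ → ℝ) (φ : Phase n → ℝ)
    (ν : ProbabilityMeasure (Phase n)) (w : Phase n × Phase n) : ℝ :=
  φ (w.1.1, w.2.2) * K (ballMass ν w.1.1 (dist w.2.1 w.1.1))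

/-- The expectation of `gainObservable` for two independent particles. -/
noncomputable def meanGain {n : ℕ} (K : ℝ → ℝ) (φ : Phase n → ℝ)
    (ν : ProbabilityMeasure (Phase n)) : ℝ :=
  ∫ w, gainObservable K φ ν w ∂((ν : Measure (Phase n)).prod (ν : Measure (Phase n)))

variable {n : ℕ}

lemma ballMass_nonneg (ν : ProbabilityMeasure (Phase n)) (x : Space n) (s : ℝ) :
    0 ≤ ballMass ν x s := measureReal_nonneg

lemma ballMass_le_one (ν : ProbabilityMeasure (Phase n)) (x : Space n) (s : ℝ) :
    ballMass ν x s ≤ 1 := measureReal_le_one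

lemma measurable_ballMass (ν : ProbabilityMeasure (Phase n)) :
    Measurable fun q : Space n × ℝ => ballMass ν q.1 q.2 := by
  have hs : MeasurableSet {p : (Space n × ℝ) × Phase n | dist p.2.1 p.1.1 ≤ p.1.2} :=
    measurableSet_le (by fun_prop) (by fun_prop)
  exact (measurable_measure_prodMk_left (ν := (ν : Measure (Phase n))) hs).ennreal_toReal

lemma measurable_ballMass_dist {α : Type*} [MeasurableSpace α] (ν : ProbabilityMeasure (Phase n))
    {x y : α → Space n} (hx : Measurable x) (hy : Measurable y) :
    Measurable fun a => ballMass ν (x a) (dist (y a) (x a)) := by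
  have := (measurable_ballMass ν).comp (hx.prodMk (hy.dist hx))
  exact this

lemma ballMass_eq_map (ν : ProbabilityMeasure (Phase n)) (x : Space n) (s : ℝ) :
    ballMass ν x s =
      ((ν.map measurable_fst.aemeasurable : ProbabilityMeasure (Space n)) :
        Measure (Space n)).real (Metric.closedBall x s) := by
  rw [ballMass, ProbabilityMeasure.toMeasure_map, map_measureReal_apply measurable_fst
    Metric.isClosed_closedBall.measurableSet]

lemma NullSpheres.map_sphere {ν : ProbabilityMeasure (Phase n)} (h : NullSpheres ν) (x : Space n)
    (s : ℝ) : ((ν.map measurable_fst.aemeasurable : ProbabilityMeasure (Space n)) :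
        Measure (Space n)) (Metric.sphere x s) = 0 := by
  rw [ProbabilityMeasure.toMeasure_map, Measure.map_apply measurable_fst
    Metric.isClosed_sphere.measurableSet]
  exact h x s

lemma continuous_ballMass {ν : ProbabilityMeasure (Phase n)} (h : NullSpheres ν) :
    Continuous fun q : Space n × ℝ => ballMass ν q.1 q.2 := by
  simp only [ballMass_eq_map]
  exact continuous_measureReal_closedBall h.map_sphere

lemma tendsto_ballMass {ι : Type*} {l : Filter ι} {νs : ι → ProbabilityMeasure (Phase n)}
    {ν : ProbabilityMeasure (Phase n)} (hν : Tendsto νs l (𝓝 ν)) (h : NullSpheres ν)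
    (x : Space n) (s : ℝ) :
    Tendsto (fun p : ι × (Space n × ℝ) => ballMass (νs p.1) p.2.1 p.2.2) (l ×ˢ 𝓝 (x, s))
      (𝓝 (ballMass ν x s)) := by
  simp only [ballMass_eq_map]
  exact tendsto_measureReal_closedBall
    (ProbabilityMeasure.tendsto_map_of_tendsto_of_continuous νs ν hν continuous_fst)
    h.map_sphere x s

lemma measurable_gainObservable {K : ℝ → ℝ} (hK : Continuous K) {φ : Phase n → ℝ}
    (hφ : Continuous φ) (ν : ProbabilityMeasure (Phase n)) :
    Measurable (gainObservable K φ ν) := by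
  have h1 : Measurable fun w : Phase n × Phase n => ballMass ν w.1.1 (dist w.2.1 w.1.1) :=
    measurable_ballMass_dist ν measurable_fst.fst measurable_snd.fst
  have h2 : Measurable fun w : Phase n × Phase n => φ (w.1.1, w.2.2) :=
    hφ.measurable.comp (measurable_fst.fst.prodMk measurable_snd.snd)
  exact h2.mul (hK.measurable.comp h1)

lemma abs_gainObservable_le {K : ℝ → ℝ} {φ : Phase n → ℝ} {A B : ℝ} (hK : ∀ r, |K r| ≤ A)
    (hφ : ∀ z, |φ z| ≤ B) (ν : ProbabilityMeasure (Phase n)) (w : Phase n × Phase n) :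
    |gainObservable K φ ν w| ≤ B * A := by
  rw [gainObservable, abs_mul]
  exact mul_le_mul (hφ _) (hK _) (abs_nonneg _) ((abs_nonneg _).trans (hφ w.1))

/-- The law enters twice, as the law of the pair and inside `K`. Product laws converge weakly, while
the integrands converge locally uniformly because ball masses converge jointly with the point of
evaluation. -/
lemma tendsto_meanGain {K : ℝ → ℝ} (hK : Continuous K) {A : ℝ} (hKA : ∀ r, |K r| ≤ A)
    {φ : Phase n → ℝ} (hφ : Continuous φ) {B : ℝ} (hφB : ∀ z, |φ z| ≤ B)
    {ι : Type*} {l : Filter ι} {νs : ι → ProbabilityMeasure (Phase n)}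
    {ν : ProbabilityMeasure (Phase n)} (hν : Tendsto νs l (𝓝 ν)) (h : NullSpheres ν) :
    Tendsto (fun i => meanGain K φ (νs i)) l (𝓝 (meanGain K φ ν)) := by
  have hprod : Tendsto (fun i => (νs i).prod (νs i)) l (𝓝 (ν.prod ν)) :=
    (ProbabilityMeasure.continuous_prod.tendsto (ν, ν)).comp (hν.prodMk_nhds hν)
  have hcont : Continuous (gainObservable K φ ν) := by
    have hpt : Continuous fun w : Phase n × Phase n => (w.1.1, dist w.2.1 w.1.1) := by fun_prop
    have hpt' : Continuous fun w : Phase n × Phase n => (w.1.1, w.2.2) := by fun_prop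
    have h1 := (continuous_ballMass h).comp hpt
    exact (hφ.comp hpt').mul (hK.comp h1)
  refine tendsto_integral_of_tendstoLocallyUniformly hprod (C := B * A)
    (fun i => (measurable_gainObservable hK hφ _).aestronglyMeasurable)
    (fun i => abs_gainObservable_le hKA hφB _) hcont (abs_gainObservable_le hKA hφB _) ?_
  rw [tendstoLocallyUniformly_iff_forall_tendsto]
  intro w
  have h1 : Tendsto (fun y : ι × (Phase n × Phase n) => gainObservable K φ ν y.2) (l ×ˢ 𝓝 w)
      (𝓝 (gainObservable K φ ν w)) := (hcont.tendsto w).comp tendsto_snd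
  have h2 : Tendsto (fun y : ι × (Phase n × Phase n) => gainObservable K φ (νs y.1) y.2)
      (l ×ˢ 𝓝 w) (𝓝 (gainObservable K φ ν w)) := by
    have hpt : Tendsto (fun w : Phase n × Phase n => (w.1.1, dist w.2.1 w.1.1)) (𝓝 w)
        (𝓝 (w.1.1, dist w.2.1 w.1.1)) := Continuous.tendsto (by fun_prop) w
    have hφw : Tendsto (fun w : Phase n × Phase n => φ (w.1.1, w.2.2)) (𝓝 w)
        (𝓝 (φ (w.1.1, w.2.2))) := by
      have hpt' : Continuous fun w : Phase n × Phase n => (w.1.1, w.2.2) := by fun_prop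
      exact (hφ.comp hpt').tendsto w
    have hball := (tendsto_ballMass hν h w.1.1 (dist w.2.1 w.1.1)).comp (tendsto_id.prodMap hpt)
    exact (hφw.comp tendsto_snd).mul ((hK.tendsto _).comp hball)
  exact (h1.prodMk_nhds h2).mono_right (nhds_le_uniformity _)

end ChooseLeader

namespace ChooseLeader

/-! ### Laws given by densities -/

section Density

variable {α : Type*} [MeasureSpace α]

/-- The law with a given density. -/
noncomputable def IsProbDensity.law {g : α → ℝ} (hg : IsProbDensity g) : ProbabilityMeasure α :=
  ⟨volume.withDensity fun z => ENNReal.ofReal (g z), ⟨by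
    rw [withDensity_apply _ MeasurableSet.univ, Measure.restrict_univ,
      ← ofReal_integral_eq_lintegral_ofReal hg.2.1 hg.1, hg.2.2, ENNReal.ofReal_one]⟩⟩

lemma IsProbDensity.law_toMeasure {g : α → ℝ} (hg : IsProbDensity g) :
    (hg.law : Measure α) = volume.withDensity fun z => ENNReal.ofReal (g z) := rfl

lemma IsProbDensity.aemeasurable {g : α → ℝ} (hg : IsProbDensity g) :
    AEMeasurable (fun z => ENNReal.ofReal (g z)) :=
  hg.2.1.aestronglyMeasurable.aemeasurable.ennreal_ofReal

lemma integral_withDensity_ofReal {g : α → ℝ} (hg : AEMeasurable g) (h0 : ∀ᵐ z, 0 ≤ g z)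
    (ψ : α → ℝ) : ∫ z, ψ z ∂(volume.withDensity fun z => ENNReal.ofReal (g z)) =
      ∫ z, g z * ψ z := by
  rw [integral_withDensity_eq_integral_toReal_smul₀ hg.ennreal_ofReal
    (ae_of_all _ fun _ => ENNReal.ofReal_lt_top)]
  refine integral_congr_ae ?_
  filter_upwards [h0] with z hz
  rw [ENNReal.toReal_ofReal hz, smul_eq_mul]

lemma IsProbDensity.integral_law {g : α → ℝ} (hg : IsProbDensity g) (ψ : α → ℝ) :
    ∫ z, ψ z ∂(hg.law : Measure α) = ∫ z, g z * ψ z :=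
  integral_withDensity_ofReal hg.2.1.aestronglyMeasurable.aemeasurable hg.1 ψ

lemma IsProbDensity.law_absolutelyContinuous {g : α → ℝ} (hg : IsProbDensity g) :
    (hg.law : Measure α) ≪ volume := withDensity_absolutelyContinuous _ _

lemma IsProbDensity.real_law_apply {g : α → ℝ} (hg : IsProbDensity g) {s : Set α}
    (hs : MeasurableSet s) : (hg.law : Measure α).real s = ∫ z in s, g z := by
  rw [measureReal_def, hg.law_toMeasure, withDensity_apply _ hs,
    ← ofReal_integral_eq_lintegral_ofReal hg.2.1.restrict (ae_restrict_of_ae hg.1),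
    ENNReal.toReal_ofReal (integral_nonneg_of_ae (ae_restrict_of_ae hg.1))]

/-- The law of independent particles has the product density. -/
lemma IsProbDensity.pi_law {ι : Type*} [Fintype ι] [SigmaFinite (volume : Measure α)]
    {g : α → ℝ} (hg : IsProbDensity g) :
    Measure.pi (fun _ : ι => (hg.law : Measure α)) =
      volume.withDensity fun Z : ι → α => ENNReal.ofReal (∏ i, g (Z i)) := by
  refine Measure.pi_eq fun s hs => ?_
  have hvol : (volume : Measure (ι → α)) = Measure.pi fun _ => volume := rfl
  have hnn : ∀ᵐ Z : ι → α, 0 ≤ ∏ i, g (Z i) := by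
    have : ∀ᵐ Z : ι → α, ∀ i, 0 ≤ g (Z i) := by
      rw [ae_all_iff]
      intro i
      exact (Measure.quasiMeasurePreserving_eval (fun _ : ι => (volume : Measure α)) i).ae hg.1
    filter_upwards [this] with Z hZ using Finset.prod_nonneg fun i _ => hZ i
  have hint : Integrable fun Z : ι → α => ∏ i, g (Z i) := Integrable.fintype_prod fun _ => hg.2.1
  rw [withDensity_apply _ (MeasurableSet.univ_pi hs), ← ofReal_integral_eq_lintegral_ofReal
    hint.restrict (ae_restrict_of_ae hnn), hvol,
    Measure.restrict_pi_pi, integral_fintype_prod_eq_prod (fun _ => g),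
    ENNReal.ofReal_prod_of_nonneg fun i _ =>
      integral_nonneg_of_ae (ae_restrict_of_ae hg.1)]
  refine Finset.prod_congr rfl fun i _ => ?_
  rw [← hg.real_law_apply (hs i), ofReal_measureReal]

end Density

/-! ### Spatial marginal and gain term of a one-particle density -/

section Phase

variable {n : ℕ}

lemma IsProbDensity.spatialDensity {f : Phase n → ℝ} (hf : IsProbDensity f) :
    IsProbDensity (spatialDensity f) := by
  refine ⟨?_, hf.2.1.integral_prod_left, ?_⟩
  · filter_upwards [Measure.ae_ae_of_ae_prod hf.1] with x hx using integral_nonneg_of_ae hx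
  · rw [← hf.2.2]
    exact (integral_prod f hf.2.1).symm

lemma IsProbDensity.map_fst_law {f : Phase n → ℝ} (hf : IsProbDensity f) :
    (hf.law : Measure (Phase n)).map Prod.fst = (hf.spatialDensity.law : Measure (Space n)) := by
  ext s hs
  rw [← measureReal_eq_measureReal_iff, map_measureReal_apply measurable_fst hs,
    hf.real_law_apply (measurable_fst hs), hf.spatialDensity.real_law_apply hs]
  have : Prod.fst ⁻¹' s = s ×ˢ (Set.univ : Set (Space n)) := by ext; simp
  rw [this]
  have := setIntegral_prod (μ := (volume : Measure (Space n))) (ν := (volume : Measure (Space n)))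
    (s := s) (t := Set.univ) f hf.2.1.integrableOn
  rw [Measure.restrict_univ] at this
  exact this

lemma IsProbDensity.ballMass_law {f : Phase n → ℝ} (hf : IsProbDensity f) (x : Space n) (s : ℝ) :
    ballMass hf.law x s = partialMass (ChooseLeader.spatialDensity f) x s := by
  rw [partialMass, ← hf.spatialDensity.real_law_apply Metric.isClosed_closedBall.measurableSet,
    ← hf.map_fst_law, map_measureReal_apply measurable_fst
      Metric.isClosed_closedBall.measurableSet]
  rfl

/-- Spheres are Lebesgue null once the space is nontrivial. For `n = 0` the sphere of radius `0` is
the whole space. -/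
lemma IsProbDensity.nullSpheres_law (hn : 1 ≤ n) {f : Phase n → ℝ} (hf : IsProbDensity f) :
    NullSpheres hf.law := by
  intro x s
  have : Nonempty (Fin n) := ⟨⟨0, hn⟩⟩
  have : Nontrivial (Space n) := inferInstance
  rw [← Measure.map_apply measurable_fst Metric.isClosed_sphere.measurableSet, hf.map_fst_law]
  exact hf.spatialDensity.law_absolutelyContinuous (Measure.addHaar_sphere _ _ _)

/-- The weak gain term is the gain functional of the law. -/
lemma IsProbDensity.integral_gainIntegrand {f : Phase n → ℝ} (hf : IsProbDensity f)
    {K : ℝ → ℝ} (hK : Continuous K) {φ : Phase n → ℝ} (hφ : Continuous φ) :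
    ∫ w, gainIntegrand K f φ w = meanGain K φ hf.law := by
  have hρ := hf.spatialDensity
  -- The velocity of the first particle does not occur in the observable, so the first factor may be
  -- replaced by its spatial marginal.
  have hmap : ((hf.law : Measure (Phase n)).prod (hf.law : Measure (Phase n))).map
      (Prod.map Prod.fst id) =
      volume.withDensity fun w : Space n × Phase n =>
        ENNReal.ofReal (ChooseLeader.spatialDensity f w.1 * f w.2) := by
    rw [← Measure.map_prod_map _ _ measurable_fst measurable_id, Measure.map_id, hf.map_fst_law,
      hρ.law_toMeasure, hf.law_toMeasure, prod_withDensity₀ hρ.aemeasurable hf.aemeasurable]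
    refine withDensity_congr_ae ?_
    filter_upwards [Measure.quasiMeasurePreserving_fst.ae hρ.1] with w hw
    exact (ENNReal.ofReal_mul hw).symm
  have hpair : Measurable fun w : Space n × Phase n =>
      φ (w.1, w.2.2) * K (ballMass hf.law w.1 (dist w.2.1 w.1)) := by
    have h1 : Measurable fun w : Space n × Phase n => ballMass hf.law w.1 (dist w.2.1 w.1) :=
      measurable_ballMass_dist hf.law measurable_fst measurable_snd.fst
    exact (hφ.measurable.comp (measurable_fst.prodMk measurable_snd.snd)).mul
      (hK.measurable.comp h1)
  have h1 : meanGain K φ hf.law = ∫ w : Space n × Phase n,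
      φ (w.1, w.2.2) * K (ballMass hf.law w.1 (dist w.2.1 w.1))
      ∂(((hf.law : Measure (Phase n)).prod (hf.law : Measure (Phase n))).map
        (Prod.map Prod.fst id)) := by
    rw [integral_map (by fun_prop) hpair.aestronglyMeasurable]
    rfl
  rw [h1, hmap, integral_withDensity_ofReal
    (hρ.2.1.mul_prod hf.2.1).aestronglyMeasurable.aemeasurable]
  · refine integral_congr_ae (ae_of_all _ fun w => ?_)
    simp only [gainIntegrand, hf.ballMass_law, dist_eq_norm]
    ring
  · filter_upwards [Measure.quasiMeasurePreserving_fst.ae hρ.1,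
      Measure.quasiMeasurePreserving_snd.ae hf.1] with w h1 h2 using mul_nonneg h1 h2

lemma IsProbDensity.integrable_gainIntegrand {f : Phase n → ℝ} (hf : IsProbDensity f)
    {K : ℝ → ℝ} (hK : Continuous K) {A : ℝ} (hKA : ∀ r, |K r| ≤ A) {φ : Phase n → ℝ}
    (hφ : Continuous φ) {B : ℝ} (hφB : ∀ z, |φ z| ≤ B) :
    Integrable (gainIntegrand K f φ) := by
  have h1 : Measurable fun w : Space n × Phase n => ballMass hf.law w.1 (dist w.2.1 w.1) :=
    measurable_ballMass_dist hf.law measurable_fst measurable_snd.fst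
  have h2 : Measurable fun w : Space n × Phase n =>
      φ (w.1, w.2.2) * K (ballMass hf.law w.1 (dist w.2.1 w.1)) :=
    (hφ.measurable.comp (measurable_fst.prodMk measurable_snd.snd)).mul (hK.measurable.comp h1)
  have := (hf.spatialDensity.2.1.mul_prod hf.2.1).bdd_mul (c := B * A) h2.aestronglyMeasurable
    (ae_of_all _ fun w => by
      rw [Real.norm_eq_abs, abs_mul]
      exact mul_le_mul (hφB _) (hKA _) (abs_nonneg _) ((abs_nonneg _).trans (hφB w.2)))
  refine this.congr (ae_of_all _ fun w => ?_)
  simp only [gainIntegrand, hf.ballMass_law, dist_eq_norm]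
  ring

end Phase

/-! ### Independence in a chaotic state -/

section Chaos

variable {n M : ℕ}

lemma sigmaFinite_volume_pi (α : Type*) [MeasureSpace α] [SigmaFinite (volume : Measure α)] :
    SigmaFinite (volume : Measure (Fin M → α)) := inferInstance

instance : SigmaFinite (volume : Measure (Fin M → Phase n)) := sigmaFinite_volume_pi _

variable {F : (Fin (M + 1) → Phase n) → ℝ}

lemma IsProbDensity.firstMarginal (hF : IsProbDensity F) : IsProbDensity (firstMarginal F) := by
  have hmp := (volume_preserving_piFinSuccAbove (fun _ : Fin (M + 1) => Phase n) 0).symm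
  have he : ∀ p : Phase n × (Fin M → Phase n),
      (MeasurableEquiv.piFinSuccAbove (fun _ : Fin (M + 1) => Phase n) 0).symm p =
        Fin.cons p.1 p.2 := fun p => by
    simp [MeasurableEquiv.piFinSuccAbove, Fin.insertNthEquiv]
  have hint : Integrable (fun p : Phase n × (Fin M → Phase n) => F (Fin.cons p.1 p.2)) := by
    have := (hmp.integrable_comp_emb (MeasurableEquiv.measurableEmbedding _)).2 hF.2.1
    simpa only [Function.comp_def, he] using this
  refine ⟨?_, hint.integral_prod_left, ?_⟩
  · have h0 : ∀ᵐ p : Phase n × (Fin M → Phase n), 0 ≤ F (Fin.cons p.1 p.2) := by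
      have := hmp.quasiMeasurePreserving.ae hF.1
      simpa only [he] using this
    filter_upwards [Measure.ae_ae_of_ae_prod h0] with x hx using integral_nonneg_of_ae hx
  · have h1 := integral_prod _ hint
    have h2 := hmp.integral_comp (MeasurableEquiv.measurableEmbedding _) F
    simp only [he] at h2
    rw [← hF.2.2, ← h2]
    exact h1.symm

/-- In a chaotic state the particles are independent, with the law of the first marginal. -/
lemma IsChaotic.integral_eq (hF : IsProbDensity F) (hc : IsChaotic F)
    (G : (Fin (M + 1) → Phase n) → ℝ) :
    ∫ Z, F Z * G Z =
      ∫ Z, G Z ∂(Measure.pi fun _ : Fin (M + 1) => (hF.firstMarginal.law : Measure (Phase n))) := by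
  have : (fun Z => ENNReal.ofReal (∏ l, ChooseLeader.firstMarginal F (Z l)))
      =ᵐ[volume] fun Z => ENNReal.ofReal (F Z) := by
    filter_upwards [hc] with Z hZ
    rw [hZ]
  rw [hF.firstMarginal.pi_law, withDensity_congr_ae this,
    integral_withDensity_ofReal hF.2.1.aestronglyMeasurable.aemeasurable hF.1]

end Chaos

end ChooseLeader

namespace ChooseLeader

/-! ### The choice of the leader among independent particles -/

section Ranking

variable {n M : ℕ}

/-- The number of particles other than `0` which are at most as far from particle `0` as `j`. -/
noncomputable def closerCount (x : Fin (M + 1) → Space n) (j : Fin (M + 1)) : ℕ :=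
  ((Finset.univ.erase 0).filter fun k => dist (x k) (x 0) ≤ dist (x j) (x 0)).card

/-- Without ties, the particles at most as far as `j` are exactly those with ranks `1, …, R 0 j`.
The count includes `j` itself, so there is no shift by one. -/
lemma IsRanking.eq_closerCount {x : Fin (M + 1) → Space n} {R : Fin (M + 1) → Fin (M + 1) → ℕ}
    (hR : IsRanking x R)
    (hx : ∀ j k, j ≠ 0 → k ≠ 0 → j ≠ k → dist (x j) (x 0) ≠ dist (x k) (x 0))
    {j : Fin (M + 1)} (hj : j ≠ 0) : R 0 j = closerCount x j := by
  have himg : ((Finset.univ.erase 0).filter fun k => dist (x k) (x 0) ≤ dist (x j) (x 0)).image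
      (R 0) = Finset.Icc 1 (R 0 j) := by
    ext m
    simp only [Finset.mem_image, Finset.mem_filter, Finset.mem_erase, Finset.mem_univ, and_true,
      Finset.mem_Icc]
    constructor
    · rintro ⟨k, ⟨hk, hd⟩, rfl⟩
      refine ⟨((hR.bijOn 0).mapsTo hk).1, ?_⟩
      by_cases hkj : k = j
      · rw [hkj]
      · exact (hR.lt_of_dist_lt 0 k j hk hj (lt_of_le_of_ne hd (hx k j hk hj hkj))).le
    · rintro ⟨h1, h2⟩
      obtain ⟨k, hk, rfl⟩ := (hR.bijOn 0).surjOn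
        (show m ∈ Set.Icc 1 M from ⟨h1, h2.trans ((hR.bijOn 0).mapsTo hj).2⟩)
      refine ⟨k, ⟨hk, ?_⟩, rfl⟩
      by_contra hlt
      exact absurd (hR.lt_of_dist_lt 0 j k hj hk (not_le.1 hlt)) (not_lt.2 h2)
  have hinj : Set.InjOn (R 0)
      ((Finset.univ.erase 0).filter fun k => dist (x k) (x 0) ≤ dist (x j) (x 0) :
        Finset (Fin (M + 1))) :=
    (hR.bijOn 0).injOn.mono fun k hk => by
      simp only [Finset.coe_filter, Finset.mem_erase, Finset.mem_univ, and_true,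
        Set.mem_ofPred_eq] at hk
      exact hk.1
  rw [closerCount, ← Finset.card_image_of_injOn hinj, himg, Nat.card_Icc, Nat.add_sub_cancel]

lemma IsRanking.sum_comp {x : Fin (M + 1) → Space n} {R : Fin (M + 1) → Fin (M + 1) → ℕ}
    (hR : IsRanking x R) (i : Fin (M + 1)) (g : ℕ → ℝ) :
    ∑ j ∈ Finset.univ.erase i, g (R i j) = ∑ k ∈ Finset.Icc 1 M, g k := by
  refine Finset.sum_nbij (R i) (fun j hj => ?_) ?_ ?_ fun _ _ => rfl
  · have := (hR.bijOn i).mapsTo (Finset.ne_of_mem_erase hj)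
    exact Finset.mem_Icc.2 this
  · exact (hR.bijOn i).injOn.mono fun j hj => Finset.ne_of_mem_erase hj
  · intro k hk
    obtain ⟨j, hj, rfl⟩ := (hR.bijOn i).surjOn (Finset.mem_Icc.1 hk)
    exact ⟨j, by simpa using hj, rfl⟩

end Ranking

/-! ### Law of large numbers for the ranks of independent particles -/

section Independent

variable {n M : ℕ} (ν : ProbabilityMeasure (Phase n))

/-- Conditioning on all particles but `k`: the inner integral averages over `k` with the others
frozen. -/
lemma integral_pi_insertNth {G : (Fin (M + 1) → Phase n) → ℝ}
    (hG : Integrable G (Measure.pi fun _ => (ν : Measure (Phase n)))) (k : Fin (M + 1)) :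
    ∫ Z, G Z ∂(Measure.pi fun _ => (ν : Measure (Phase n))) =
      ∫ W, ∫ z, G (k.insertNth z W) ∂(ν : Measure (Phase n))
        ∂(Measure.pi fun _ : Fin M => (ν : Measure (Phase n))) := by
  have hmp := (measurePreserving_piFinSuccAbove
    (fun _ : Fin (M + 1) => (ν : Measure (Phase n))) k).symm
  have he : ∀ p : Phase n × (Fin M → Phase n),
      (MeasurableEquiv.piFinSuccAbove (fun _ : Fin (M + 1) => Phase n) k).symm p =
        k.insertNth p.1 p.2 := fun p => rfl
  have hint := (hmp.integrable_comp_emb (MeasurableEquiv.measurableEmbedding _)).2 hG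
  rw [← hmp.integral_comp (MeasurableEquiv.measurableEmbedding _) G]
  simp only [he, Function.comp_def] at hint ⊢
  exact integral_prod_symm _ hint

lemma integral_pi_pair {h : Phase n × Phase n → ℝ} (hm : Measurable h) {C : ℝ}
    (hC : ∀ w, |h w| ≤ C) {j : Fin (M + 1)} (hj : j ≠ 0) :
    ∫ Z, h (Z 0, Z j) ∂(Measure.pi fun _ : Fin (M + 1) => (ν : Measure (Phase n))) =
      ∫ w, h w ∂((ν : Measure (Phase n)).prod (ν : Measure (Phase n))) := by
  have hmZ : Measurable fun Z : Fin (M + 1) → Phase n => h (Z 0, Z j) :=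
    hm.comp ((measurable_pi_apply 0).prodMk (measurable_pi_apply j))
  obtain ⟨o, ho⟩ := Fin.exists_succAbove_eq hj.symm
  rw [integral_pi_insertNth ν (integrable_of_bounded _ hmZ.aestronglyMeasurable fun _ => hC _) j,
    integral_prod _ (integrable_of_bounded _ hm.aestronglyMeasurable hC)]
  have : ∀ (W : Fin M → Phase n) (z : Phase n), (j.insertNth z W : Fin (M + 1) → Phase n) 0 = W o :=
    fun W z => by
      have := Fin.insertNth_apply_succAbove (α := fun _ => Phase n) j z W o
      rwa [ho] at this
  simp only [this, Fin.insertNth_apply_same]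
  exact integral_comp_eval (μ := fun _ : Fin M => (ν : Measure (Phase n)))
    (f := fun z => ∫ y, h (z, y) ∂(ν : Measure (Phase n)))
    (StronglyMeasurable.integral_prod_right (f := fun z y => h (z, y))
      hm.stronglyMeasurable).aestronglyMeasurable

/-- Almost surely no two particles are at the same distance from particle `0`. -/
lemma ae_dist_ne (hν : NullSpheres ν) :
    ∀ᵐ Z ∂(Measure.pi fun _ : Fin (M + 1) => (ν : Measure (Phase n))), ∀ j k, j ≠ 0 → k ≠ 0 →
      j ≠ k → dist (Z j).1 (Z 0).1 ≠ dist (Z k).1 (Z 0).1 := by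
  rw [ae_all_iff]; intro j
  rw [ae_all_iff]; intro k
  by_cases hj : j = 0
  · exact ae_of_all _ fun Z h => absurd hj h
  by_cases hjk : j = k
  · exact ae_of_all _ fun Z _ _ h => absurd hjk h
  let s : Set (Fin (M + 1) → Phase n) := {Z | dist (Z j).1 (Z 0).1 = dist (Z k).1 (Z 0).1}
  have hs : MeasurableSet s :=
    measurableSet_eq_fun ((measurable_pi_apply j).fst.dist (measurable_pi_apply 0).fst)
      ((measurable_pi_apply k).fst.dist (measurable_pi_apply 0).fst)
  have hint : Integrable (s.indicator (1 : (Fin (M + 1) → Phase n) → ℝ))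
      (Measure.pi fun _ => (ν : Measure (Phase n))) :=
    (integrable_indicator_iff hs).2 (integrable_const (1 : ℝ)).integrableOn
  obtain ⟨o, ho⟩ := Fin.exists_succAbove_eq (Ne.symm hj)
  obtain ⟨k', hk'⟩ := Fin.exists_succAbove_eq (Ne.symm hjk)
  have h0 := integral_pi_insertNth ν hint j
  rw [integral_indicator_one hs] at h0
  -- With the other particles frozen, a tie puts `j` on the sphere about particle `0` through `k`,
  -- which is null.
  have hz : ∀ W : Fin M → Phase n,
      ∫ z, s.indicator (1 : (Fin (M + 1) → Phase n) → ℝ) (j.insertNth z W)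
        ∂(ν : Measure (Phase n)) = 0 := by
    intro W
    refine integral_eq_zero_of_ae ?_
    have := hν (W o).1 (dist (W k').1 (W o).1)
    filter_upwards [measure_eq_zero_iff_ae_notMem.1 this] with z hz
    refine Set.indicator_of_notMem (fun hmem => hz ?_) _
    have e1 := Fin.insertNth_apply_succAbove (α := fun _ => Phase n) j z W o
    have e2 := Fin.insertNth_apply_succAbove (α := fun _ => Phase n) j z W k'
    rw [ho] at e1
    rw [hk'] at e2
    have hd : dist z.1 (W o).1 = dist (W k').1 (W o).1 := by
      simpa only [s, Set.mem_ofPred_eq, e1, e2, Fin.insertNth_apply_same] using hmem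
    exact hd
  simp only [hz, integral_zero] at h0
  have h1 := (measureReal_eq_zero_iff (measure_ne_top _ _)).1 h0
  filter_upwards [measure_eq_zero_iff_ae_notMem.1 h1] with Z hZ _ _ _ using hZ

/-- The centred indicator that particle `k` is at most as far from particle `0` as `j`. -/
noncomputable def fluctuation (j k : Fin (M + 1)) (Z : Fin (M + 1) → Phase n) : ℝ :=
  (if dist (Z k).1 (Z 0).1 ≤ dist (Z j).1 (Z 0).1 then 1 else 0) -
    ballMass ν (Z 0).1 (dist (Z j).1 (Z 0).1)

lemma measurable_fluctuation (j k : Fin (M + 1)) : Measurable (fluctuation ν j k) := by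
  refine Measurable.sub (Measurable.ite ?_ measurable_const measurable_const)
    (measurable_ballMass_dist ν (measurable_pi_apply 0).fst (measurable_pi_apply j).fst)
  exact measurableSet_le ((measurable_pi_apply k).fst.dist (measurable_pi_apply 0).fst)
    ((measurable_pi_apply j).fst.dist (measurable_pi_apply 0).fst)

lemma abs_fluctuation_le (j k : Fin (M + 1)) (Z : Fin (M + 1) → Phase n) :
    |fluctuation ν j k Z| ≤ 1 := by
  have h0 := ballMass_nonneg ν (Z 0).1 (dist (Z j).1 (Z 0).1)
  have h1 := ballMass_le_one ν (Z 0).1 (dist (Z j).1 (Z 0).1)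
  rw [fluctuation, abs_le]
  split_ifs <;> constructor <;> linarith

lemma abs_fluctuation_mul_le (j k m : Fin (M + 1)) (Z : Fin (M + 1) → Phase n) :
    |fluctuation ν j k Z * fluctuation ν j m Z| ≤ 1 := by
  rw [abs_mul]
  exact mul_le_one₀ (abs_fluctuation_le ν j k Z) (abs_nonneg _) (abs_fluctuation_le ν j m Z)

lemma integrable_fluctuation_mul (j k m : Fin (M + 1)) :
    Integrable (fun Z => fluctuation ν j k Z * fluctuation ν j m Z)
      (Measure.pi fun _ => (ν : Measure (Phase n))) :=
  integrable_of_bounded _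
    ((measurable_fluctuation ν j k).mul (measurable_fluctuation ν j m)).aestronglyMeasurable
    (abs_fluctuation_mul_le ν j k m)

/-- Averaging over particle `k` alone annihilates the first factor, which is centred, while the
second factor does not involve `k`. -/
lemma integral_fluctuation_mul {j k m : Fin (M + 1)} (hk : k ≠ 0) (hkj : k ≠ j) (hkm : k ≠ m) :
    ∫ Z, fluctuation ν j k Z * fluctuation ν j m Z
      ∂(Measure.pi fun _ => (ν : Measure (Phase n))) = 0 := by
  rw [integral_pi_insertNth ν (integrable_fluctuation_mul ν j k m) k]
  obtain ⟨o, ho⟩ := Fin.exists_succAbove_eq hk.symm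
  obtain ⟨j', hj'⟩ := Fin.exists_succAbove_eq hkj.symm
  obtain ⟨m', hm'⟩ := Fin.exists_succAbove_eq hkm.symm
  refine integral_eq_zero_of_ae (ae_of_all _ fun W => ?_)
  have e : ∀ i z, (k.insertNth z W : Fin (M + 1) → Phase n) (k.succAbove i) = W i :=
    fun i z => Fin.insertNth_apply_succAbove (α := fun _ => Phase n) k z W i
  have eo : ∀ z, (k.insertNth z W : Fin (M + 1) → Phase n) 0 = W o := fun z => by rw [← e, ho]
  have ej : ∀ z, (k.insertNth z W : Fin (M + 1) → Phase n) j = W j' := fun z => by rw [← e, hj']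
  have em : ∀ z, (k.insertNth z W : Fin (M + 1) → Phase n) m = W m' := fun z => by rw [← e, hm']
  simp only [fluctuation, eo, ej, em, Fin.insertNth_apply_same, Pi.zero_apply]
  rw [integral_mul_const]
  set x := (W o).1
  set r := dist (W j').1 x
  have hset : MeasurableSet (Prod.fst ⁻¹' Metric.closedBall x r : Set (Phase n)) :=
    measurable_fst Metric.isClosed_closedBall.measurableSet
  have hind : (fun z : Phase n => if dist z.1 x ≤ r then (1 : ℝ) else 0) =
      (Prod.fst ⁻¹' Metric.closedBall x r).indicator 1 := by
    funext z
    by_cases h : dist z.1 x ≤ r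
    · rw [if_pos h, Set.indicator_of_mem (show z ∈ Prod.fst ⁻¹' Metric.closedBall x r from h),
        Pi.one_apply]
    · rw [if_neg h, Set.indicator_of_notMem (show z ∉ Prod.fst ⁻¹' Metric.closedBall x r from h)]
  have hint : Integrable (fun z : Phase n => if dist z.1 x ≤ r then (1 : ℝ) else 0)
      (ν : Measure (Phase n)) := by
    rw [hind]
    exact (integrable_indicator_iff hset).2 (integrable_const (1 : ℝ)).integrableOn
  rw [integral_sub hint (integrable_const _), hind, integral_indicator_one hset]
  simp [ballMass]

/-- The off-diagonal terms vanish, and each of the `M` diagonal ones is at most `1`. -/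
lemma integral_sum_fluctuation_sq_le {j : Fin (M + 1)} :
    ∫ Z, (∑ k ∈ Finset.univ.erase 0, fluctuation ν j k Z) ^ 2
      ∂(Measure.pi fun _ => (ν : Measure (Phase n))) ≤ M := by
  simp only [sq, Finset.sum_mul_sum]
  rw [integral_finsetSum _ fun k _ => integrable_finsetSum _ fun m _ =>
    integrable_fluctuation_mul ν j k m]
  have hk : ∀ k ∈ (Finset.univ : Finset (Fin (M + 1))).erase 0,
      ∫ Z, ∑ m ∈ Finset.univ.erase 0, fluctuation ν j k Z * fluctuation ν j m Z
        ∂(Measure.pi fun _ => (ν : Measure (Phase n))) ≤ 1 := by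
    intro k hk
    rw [integral_finsetSum _ fun m _ => integrable_fluctuation_mul ν j k m,
      Finset.sum_eq_single_of_mem k hk]
    · have := abs_integral_sub_le (Measure.pi fun _ => (ν : Measure (Phase n)))
        (integrable_fluctuation_mul ν j k k) (integrable_const 0) (integrable_const 1) fun Z => by
          rw [sub_zero]; exact abs_fluctuation_mul_le ν j k k Z
      simp only [integral_const, probReal_univ, smul_eq_mul, mul_zero, sub_zero, mul_one] at this
      exact (le_abs_self _).trans this
    · intro m hm hmk
      -- The term with index `j` is not centred, but two distinct indices cannot both equal `j`: the
      -- other one is averaged out.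
      by_cases hkj : k = j
      · simp_rw [mul_comm (fluctuation ν j k _)]
        exact integral_fluctuation_mul ν (Finset.ne_of_mem_erase hm) (hkj ▸ hmk) hmk
      · exact integral_fluctuation_mul ν (Finset.ne_of_mem_erase hk) hkj hmk.symm
  refine (Finset.sum_le_sum hk).trans ?_
  simp

lemma closerCount_sub (j : Fin (M + 1)) (Z : Fin (M + 1) → Phase n) :
    (closerCount (fun l => (Z l).1) j : ℝ) - M * ballMass ν (Z 0).1 (dist (Z j).1 (Z 0).1) =
      ∑ k ∈ Finset.univ.erase 0, fluctuation ν j k Z := by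
  simp [fluctuation, Finset.sum_sub_distrib, closerCount]

lemma measurable_closerCount (j : Fin (M + 1)) :
    Measurable fun Z : Fin (M + 1) → Phase n => (closerCount (fun l => (Z l).1) j : ℝ) := by
  have : (fun Z : Fin (M + 1) → Phase n => (closerCount (fun l => (Z l).1) j : ℝ)) =
      fun Z => ∑ k ∈ Finset.univ.erase 0,
        if dist (Z k).1 (Z 0).1 ≤ dist (Z j).1 (Z 0).1 then (1 : ℝ) else 0 := by
    ext Z
    simp [closerCount]
  rw [this]
  refine Finset.measurable_fun_sum _ fun k _ => Measurable.ite ?_ measurable_const measurable_const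
  exact measurableSet_le ((measurable_pi_apply k).fst.dist (measurable_pi_apply 0).fst)
    ((measurable_pi_apply j).fst.dist (measurable_pi_apply 0).fst)

lemma abs_sub_le_of_bounded {K : ℝ → ℝ} {A : ℝ} (hA : ∀ r, |K r| ≤ A) (a b : ℝ) :
    |K a - K b| ≤ 2 * A :=
  (abs_sub _ _).trans (by linarith [hA a, hA b])

/-- The law of large numbers for the rank of particle `j`. -/
lemma integral_abs_comp_closerCount_sub_le {K : ℝ → ℝ} (hK : Continuous K) {A : ℝ}
    (hA : ∀ r, |K r| ≤ A) {ε δ : ℝ} (hε : 0 ≤ ε) (hδ : 0 < δ)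
    (hKδ : ∀ a b, |a - b| < δ → |K a - K b| ≤ ε) (hM : 0 < M) (j : Fin (M + 1)) :
    ∫ Z, |K (closerCount (fun l => (Z l).1) j / M) -
        K (ballMass ν (Z 0).1 (dist (Z j).1 (Z 0).1))|
      ∂(Measure.pi fun _ => (ν : Measure (Phase n))) ≤ ε + 2 * A / (δ ^ 2 * M) := by
  have hM' : (0 : ℝ) < M := by exact_mod_cast hM
  have hA0 : 0 ≤ A := (abs_nonneg _).trans (hA 0)
  set c := 2 * A / (δ ^ 2 * M ^ 2) with hc
  have hc0 : 0 ≤ c := by positivity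
  have hsq : Integrable (fun Z => (∑ k ∈ Finset.univ.erase 0, fluctuation ν j k Z) ^ 2)
      (Measure.pi fun _ => (ν : Measure (Phase n))) := by
    simp only [sq, Finset.sum_mul_sum]
    exact integrable_finsetSum _ fun k _ => integrable_finsetSum _ fun m _ =>
      integrable_fluctuation_mul ν j k m
  -- Chebyshev's argument pointwise: where rank over `M` misses the ball mass by at least `δ`, the
  -- trivial bound `2 * A` is multiplied by the squared deviation over `δ ^ 2`, which is at least
  -- `1`. This fixes the constant `c`.
  have hpt : ∀ Z : Fin (M + 1) → Phase n, |K (closerCount (fun l => (Z l).1) j / M) -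
      K (ballMass ν (Z 0).1 (dist (Z j).1 (Z 0).1))| ≤
        ε + c * (∑ k ∈ Finset.univ.erase 0, fluctuation ν j k Z) ^ 2 := by
    intro Z
    rw [← closerCount_sub]
    set a : ℝ := ((closerCount (fun l => (Z l).1) j : ℕ) : ℝ)
    set p := ballMass ν (Z 0).1 (dist (Z j).1 (Z 0).1)
    by_cases h : |a / M - p| < δ
    · exact (hKδ _ _ h).trans (le_add_of_nonneg_right (by positivity))
    · have h1 : δ ^ 2 ≤ (a / M - p) ^ 2 := by
        rw [← sq_abs (a / M - p)]
        exact pow_le_pow_left₀ hδ.le (not_lt.1 h) 2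
      have h2 : |K (a / M) - K p| ≤ 2 * A :=
        abs_sub_le_of_bounded hA _ _
      have h3 : c * (a - M * p) ^ 2 = 2 * A * ((a / M - p) ^ 2 / δ ^ 2) := by
        rw [hc]; field_simp
      have h4 : 1 ≤ (a / M - p) ^ 2 / δ ^ 2 := (one_le_div (by positivity)).2 h1
      rw [h3]
      nlinarith [mul_le_mul_of_nonneg_left h4 (by positivity : 0 ≤ 2 * A)]
  have hmeas : Measurable fun Z : Fin (M + 1) → Phase n =>
      |K (closerCount (fun l => (Z l).1) j / M) -
        K (ballMass ν (Z 0).1 (dist (Z j).1 (Z 0).1))| :=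
    ((hK.measurable.comp ((measurable_closerCount j).div_const _)).sub (hK.measurable.comp
      (measurable_ballMass_dist ν (measurable_pi_apply 0).fst (measurable_pi_apply j).fst))).abs
  have hint := integrable_of_bounded (Measure.pi fun _ => (ν : Measure (Phase n)))
    hmeas.aestronglyMeasurable (C := 2 * A) fun Z => by
      rw [abs_abs]
      exact abs_sub_le_of_bounded hA _ _
  refine (integral_mono hint ((integrable_const ε).add (hsq.const_mul c)) hpt).trans ?_
  rw [integral_add' (integrable_const ε) (hsq.const_mul c), integral_const_mul]
  simp only [integral_const, probReal_univ, smul_eq_mul, one_mul]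
  have := mul_le_mul_of_nonneg_left (integral_sum_fluctuation_sq_le ν (j := j)) hc0
  have e : c * M = 2 * A / (δ ^ 2 * M) := by rw [hc]; field_simp
  linarith

lemma integrable_comp_closerCount_mul {K : ℝ → ℝ} (hK : Continuous K) {A : ℝ}
    (hA : ∀ r, |K r| ≤ A) {φ : Phase n → ℝ} (hφ : Continuous φ) {B : ℝ} (hB : ∀ z, |φ z| ≤ B)
    (j : Fin (M + 1)) :
    Integrable (fun Z : Fin (M + 1) → Phase n =>
      K (closerCount (fun l => (Z l).1) j / M) * φ ((Z 0).1, (Z j).2))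
      (Measure.pi fun _ => (ν : Measure (Phase n))) := by
  have hφm : Measurable fun Z : Fin (M + 1) → Phase n => φ ((Z 0).1, (Z j).2) :=
    hφ.measurable.comp ((measurable_pi_apply 0).fst.prodMk (measurable_pi_apply j).snd)
  have hcm : Measurable fun Z : Fin (M + 1) → Phase n =>
      K (closerCount (fun l => (Z l).1) j / M) :=
    hK.measurable.comp ((measurable_closerCount j).div_const _)
  exact integrable_of_bounded _ (hcm.mul hφm).aestronglyMeasurable (C := A * B) fun Z => by
    rw [abs_mul]
    exact mul_le_mul (hA _) (hB _) (abs_nonneg _) ((abs_nonneg _).trans (hA 0))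

/-- The expected value of an observable at particle `0` after it adopted a velocity. -/
noncomputable def leaderMean (K : ℝ → ℝ) (φ : Phase n → ℝ)
    (R : (Fin (M + 1) → Space n) → Fin (M + 1) → Fin (M + 1) → ℕ)
    (Z : Fin (M + 1) → Phase n) : ℝ :=
  ∑ j ∈ Finset.univ.erase 0, leaderProb K M (R (fun l => (Z l).1) 0 j) * φ ((Z 0).1, (Z j).2)

/-- The ranking breaks ties arbitrarily, with no measurability in the configuration. Off the null
set of ties it is determined, which also makes `leaderMean` almost everywhere measurable. -/
lemma leaderMean_ae_eq (hν : NullSpheres ν) (K : ℝ → ℝ) (φ : Phase n → ℝ)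
    {R : (Fin (M + 1) → Space n) → Fin (M + 1) → Fin (M + 1) → ℕ} (hR : ∀ x, IsRanking x (R x)) :
    leaderMean K φ R =ᵐ[Measure.pi fun _ => (ν : Measure (Phase n))]
      fun Z => (∑ k ∈ Finset.Icc 1 M, K ((k : ℝ) / M))⁻¹ * ∑ j ∈ Finset.univ.erase 0,
        K (closerCount (fun l => (Z l).1) j / M) * φ ((Z 0).1, (Z j).2) := by
  filter_upwards [ae_dist_ne (M := M) ν hν] with Z hZ
  rw [leaderMean, Finset.mul_sum]
  refine Finset.sum_congr rfl fun j hj => ?_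
  rw [(hR fun l => (Z l).1).eq_closerCount hZ (Finset.ne_of_mem_erase hj), leaderProb]
  ring

lemma integrable_leaderMean (hν : NullSpheres ν) {K : ℝ → ℝ} (hK : Continuous K) {A : ℝ}
    (hA : ∀ r, |K r| ≤ A) {φ : Phase n → ℝ} (hφ : Continuous φ) {B : ℝ} (hB : ∀ z, |φ z| ≤ B)
    {R : (Fin (M + 1) → Space n) → Fin (M + 1) → Fin (M + 1) → ℕ} (hR : ∀ x, IsRanking x (R x)) :
    Integrable (leaderMean K φ R) (Measure.pi fun _ => (ν : Measure (Phase n))) :=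
  ((integrable_finsetSum _ fun j _ =>
    integrable_comp_closerCount_mul ν hK hA hφ hB j).const_mul _).congr
    (leaderMean_ae_eq ν hν K φ hR).symm

lemma sum_leaderProb {K : ℝ → ℝ} (hS : ∑ k ∈ Finset.Icc 1 M, K ((k : ℝ) / M) ≠ 0)
    {x : Fin (M + 1) → Space n} {R : Fin (M + 1) → Fin (M + 1) → ℕ} (hR : IsRanking x R)
    (i : Fin (M + 1)) : ∑ j ∈ Finset.univ.erase i, leaderProb K M (R i j) = 1 := by
  rw [hR.sum_comp i (leaderProb K M)]
  simp only [leaderProb]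
  rw [← Finset.sum_div, div_self hS]

/-- `leaderMean` is a convex combination of values of `φ`. The bound does not depend on `M`, as the
uniform Lipschitz estimate in time requires. -/
lemma abs_leaderMean_le {K : ℝ → ℝ} (hK0 : ∀ r, 0 ≤ K r)
    (hS : 0 < ∑ k ∈ Finset.Icc 1 M, K ((k : ℝ) / M)) {φ : Phase n → ℝ} {B : ℝ}
    (hB : ∀ z, |φ z| ≤ B)
    {R : (Fin (M + 1) → Space n) → Fin (M + 1) → Fin (M + 1) → ℕ} (hR : ∀ x, IsRanking x (R x))
    (Z : Fin (M + 1) → Phase n) : |leaderMean K φ R Z| ≤ B := by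
  have h : ∀ r, 0 ≤ leaderProb K M r := fun r => div_nonneg (hK0 _) hS.le
  calc |leaderMean K φ R Z|
      ≤ ∑ j ∈ Finset.univ.erase 0, leaderProb K M (R (fun l => (Z l).1) 0 j) * B := by
        refine (Finset.abs_sum_le_sum_abs _ _).trans (Finset.sum_le_sum fun j _ => ?_)
        rw [abs_mul, abs_of_nonneg (h _)]
        exact mul_le_mul_of_nonneg_left (hB _) (h _)
    _ = B := by rw [← Finset.sum_mul, sum_leaderProb hS.ne' (hR _), one_mul]

/-- Propagation of chaos for the velocity adopted by particle `0`. -/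
lemma abs_integral_leader_sub_le (hν : NullSpheres ν) {K : ℝ → ℝ} (hK : Continuous K) {A : ℝ}
    (hA : ∀ r, |K r| ≤ A) {ε δ : ℝ} (hε : 0 ≤ ε) (hδ : 0 < δ)
    (hKδ : ∀ a b, |a - b| < δ → |K a - K b| ≤ ε) (hM : 0 < M)
    (hS : 0 < ∑ k ∈ Finset.Icc 1 M, K ((k : ℝ) / M))
    {φ : Phase n → ℝ} (hφ : Continuous φ) {B : ℝ} (hB : ∀ z, |φ z| ≤ B)
    {R : (Fin (M + 1) → Space n) → Fin (M + 1) → Fin (M + 1) → ℕ} (hR : ∀ x, IsRanking x (R x)) :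
    |∫ Z, leaderMean K φ R Z ∂(Measure.pi fun _ => (ν : Measure (Phase n))) -
      M / (∑ k ∈ Finset.Icc 1 M, K ((k : ℝ) / M)) * meanGain K φ ν| ≤
    M / (∑ k ∈ Finset.Icc 1 M, K ((k : ℝ) / M)) * (B * (ε + 2 * A / (δ ^ 2 * M))) := by
  set S := ∑ k ∈ Finset.Icc 1 M, K ((k : ℝ) / M) with hSdef
  have hB0 : 0 ≤ B := (abs_nonneg _).trans (hB 0)
  have hφm : ∀ j : Fin (M + 1), Measurable fun Z : Fin (M + 1) → Phase n =>
      φ ((Z 0).1, (Z j).2) := fun j =>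
    hφ.measurable.comp ((measurable_pi_apply 0).fst.prodMk (measurable_pi_apply j).snd)
  have hcm : ∀ j : Fin (M + 1), Measurable fun Z : Fin (M + 1) → Phase n =>
      K (closerCount (fun l => (Z l).1) j / M) := fun j =>
    hK.measurable.comp ((measurable_closerCount j).div_const _)
  have hbm : ∀ j : Fin (M + 1), Measurable fun Z : Fin (M + 1) → Phase n =>
      K (ballMass ν (Z 0).1 (dist (Z j).1 (Z 0).1)) := fun j => hK.measurable.comp
      (measurable_ballMass_dist ν (measurable_pi_apply 0).fst (measurable_pi_apply j).fst)
  have hI1 := integrable_comp_closerCount_mul (M := M) ν hK hA hφ hB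
  have hI2 : ∀ j : Fin (M + 1), Integrable (fun Z : Fin (M + 1) → Phase n =>
      K (ballMass ν (Z 0).1 (dist (Z j).1 (Z 0).1)) * φ ((Z 0).1, (Z j).2))
      (Measure.pi fun _ => (ν : Measure (Phase n))) := fun j =>
    integrable_of_bounded _ ((hbm j).mul (hφm j)).aestronglyMeasurable (C := A * B) fun Z => by
      rw [abs_mul]
      exact mul_le_mul (hA _) (hB _) (abs_nonneg _) ((abs_nonneg _).trans (hA 0))
  have hI3 : ∀ j : Fin (M + 1), Integrable (fun Z : Fin (M + 1) → Phase n =>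
      B * |K (closerCount (fun l => (Z l).1) j / M) -
        K (ballMass ν (Z 0).1 (dist (Z j).1 (Z 0).1))|)
      (Measure.pi fun _ => (ν : Measure (Phase n))) := fun j =>
    Integrable.const_mul (integrable_of_bounded _
      ((hcm j).sub (hbm j)).abs.aestronglyMeasurable (C := 2 * A) fun Z => by
        rw [abs_abs]
        exact abs_sub_le_of_bounded hA _ _) B
  have hcount : ∫ Z, leaderMean K φ R Z ∂(Measure.pi fun _ => (ν : Measure (Phase n))) =
      S⁻¹ * ∑ j ∈ Finset.univ.erase 0, ∫ Z : Fin (M + 1) → Phase n,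
        K (closerCount (fun l => (Z l).1) j / M) * φ ((Z 0).1, (Z j).2)
        ∂(Measure.pi fun _ => (ν : Measure (Phase n))) := by
    rw [← integral_finsetSum _ fun j _ => hI1 j, ← integral_const_mul]
    exact integral_congr_ae (leaderMean_ae_eq ν hν K φ hR)
  -- Each pair `(Z 0, Z j)` has law `ν ⊗ ν`, so the `M` possible leaders contribute equally.
  have hmean : (M : ℝ) * meanGain K φ ν = ∑ j ∈ (Finset.univ : Finset (Fin (M + 1))).erase 0,
      ∫ Z : Fin (M + 1) → Phase n,
        K (ballMass ν (Z 0).1 (dist (Z j).1 (Z 0).1)) * φ ((Z 0).1, (Z j).2)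
        ∂(Measure.pi fun _ => (ν : Measure (Phase n))) := by
    have : ∀ j ∈ (Finset.univ : Finset (Fin (M + 1))).erase 0, ∫ Z : Fin (M + 1) → Phase n,
        K (ballMass ν (Z 0).1 (dist (Z j).1 (Z 0).1)) * φ ((Z 0).1, (Z j).2)
        ∂(Measure.pi fun _ => (ν : Measure (Phase n))) = meanGain K φ ν := by
      intro j hj
      rw [meanGain, ← integral_pi_pair ν (measurable_gainObservable hK hφ ν)
        (abs_gainObservable_le hA hB ν) (Finset.ne_of_mem_erase hj)]
      simp only [gainObservable, mul_comm]
    rw [Finset.sum_congr rfl this]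
    simp
  have hdiff : ∀ j ∈ (Finset.univ : Finset (Fin (M + 1))).erase 0,
      |∫ Z : Fin (M + 1) → Phase n, K (closerCount (fun l => (Z l).1) j / M) *
          φ ((Z 0).1, (Z j).2) ∂(Measure.pi fun _ => (ν : Measure (Phase n))) -
        ∫ Z : Fin (M + 1) → Phase n, K (ballMass ν (Z 0).1 (dist (Z j).1 (Z 0).1)) *
          φ ((Z 0).1, (Z j).2) ∂(Measure.pi fun _ => (ν : Measure (Phase n)))| ≤
      B * (ε + 2 * A / (δ ^ 2 * M)) := by
    intro j _
    refine (abs_integral_sub_le _ (hI1 j) (hI2 j) (hI3 j) fun Z => ?_).trans ?_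
    · rw [← sub_mul, abs_mul, mul_comm]
      exact mul_le_mul_of_nonneg_right (hB _) (abs_nonneg _)
    · rw [integral_const_mul]
      exact mul_le_mul_of_nonneg_left
        (integral_abs_comp_closerCount_sub_le ν hK hA hε hδ hKδ hM j) hB0
  have hsum := (Finset.abs_sum_le_sum_abs _ _).trans (Finset.sum_le_sum hdiff)
  rw [Finset.sum_sub_distrib, ← hmean, Finset.sum_const, Finset.card_erase_of_mem
    (Finset.mem_univ _), Finset.card_univ, Fintype.card_fin, Nat.add_sub_cancel,
    nsmul_eq_mul] at hsum
  rw [hcount, div_eq_inv_mul, mul_assoc, ← mul_sub, abs_mul, abs_of_pos (inv_pos.2 hS), mul_assoc]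
  exact mul_le_mul_of_nonneg_left hsum (inv_pos.2 hS).le

end Independent

end ChooseLeader

namespace ChooseLeader

/-! ### Riemann sums, limits of differential equations, and nonnegativity -/

/-- On each cell of length `1 / M < δ`, `K` differs from its value at the right endpoint by at most
`ε / 2`. -/
lemma tendsto_riemann_sum {K : ℝ → ℝ} (hK : UniformContinuous K) :
    Tendsto (fun M : ℕ => (∑ k ∈ Finset.Icc 1 M, K ((k : ℝ) / M)) / M) atTop
      (𝓝 (∫ r in (0 : ℝ)..1, K r)) := by
  rw [Metric.tendsto_nhds]
  intro ε hε
  obtain ⟨δ, hδ, hKδ⟩ := Metric.uniformContinuous_iff.1 hK (ε / 2) (by positivity)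
  obtain ⟨m, hm⟩ := exists_nat_gt (1 / δ)
  filter_upwards [eventually_ge_atTop m, eventually_gt_atTop 0] with M hM hM0
  have hM' : (0 : ℝ) < M := by exact_mod_cast hM0
  have hδM : 1 / (M : ℝ) < δ := by
    have : (m : ℝ) ≤ M := by exact_mod_cast hM
    rw [div_lt_iff₀ hM']
    rw [div_lt_iff₀ hδ] at hm
    nlinarith
  have hii : ∀ a b : ℝ, IntervalIntegrable K volume a b := fun a b =>
    hK.continuous.intervalIntegrable a b
  have hsplit := intervalIntegral.sum_integral_adjacent_intervals (f := K) (μ := volume)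
    (a := fun k : ℕ => (k : ℝ) / M) (n := M) fun k _ => hii _ _
  simp only [Nat.cast_zero, zero_div, div_self hM'.ne'] at hsplit
  have hsum : (∑ k ∈ Finset.Icc 1 M, K ((k : ℝ) / M)) / M =
      ∑ k ∈ Finset.range M, K (((k + 1 : ℕ) : ℝ) / M) * (1 / M) := by
    rw [← Finset.sum_mul, mul_one_div, Finset.range_eq_Ico,
      Finset.sum_Ico_add' (fun k : ℕ => K ((k : ℝ) / M)) 0 M 1]
    rfl
  rw [hsum, ← hsplit, Real.dist_eq, ← Finset.sum_sub_distrib]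
  have hk : ∀ k ∈ Finset.range M, |K (((k + 1 : ℕ) : ℝ) / M) * (1 / M) -
      ∫ r in ((k : ℝ) / M)..(((k + 1 : ℕ) : ℝ) / M), K r| ≤ ε / 2 * (1 / M) := by
    intro k _
    have hlen : ((k + 1 : ℕ) : ℝ) / M - (k : ℝ) / M = 1 / M := by push_cast; ring
    have hconst : K (((k + 1 : ℕ) : ℝ) / M) * (1 / M) =
        ∫ _ in ((k : ℝ) / M)..(((k + 1 : ℕ) : ℝ) / M), K (((k + 1 : ℕ) : ℝ) / M) := by
      rw [intervalIntegral.integral_const, hlen, smul_eq_mul, mul_comm]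
    rw [hconst, ← intervalIntegral.integral_sub intervalIntegrable_const (hii _ _)]
    have hle : (k : ℝ) / M ≤ ((k + 1 : ℕ) : ℝ) / M := by
      rw [← sub_nonneg, hlen]; positivity
    have := intervalIntegral.norm_integral_le_of_norm_le_const (C := ε / 2)
      (a := (k : ℝ) / M) (b := ((k + 1 : ℕ) : ℝ) / M)
      (f := fun r => K (((k + 1 : ℕ) : ℝ) / M) - K r) fun r hr => by
        rw [Set.uIoc_of_le hle] at hr
        refine (hKδ ?_).le
        rw [Real.dist_eq, abs_of_nonneg (by linarith [hr.2])]
        linarith [hr.1]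
    rwa [hlen, abs_of_pos (by positivity : (0 : ℝ) < 1 / M)] at this
  refine ((Finset.abs_sum_le_sum_abs _ _).trans (Finset.sum_le_sum hk)).trans_lt ?_
  rw [Finset.sum_const, Finset.card_range, nsmul_eq_mul]
  have : (M : ℝ) * (ε / 2 * (1 / M)) = ε / 2 := by field_simp
  linarith

section Time

variable {g A : ℝ → ℝ} {gs As : ℕ → ℝ → ℝ} {C : ℝ}

/-- The mean value inequality gives a Lipschitz constant independent of `k`, which survives
pointwise limits. -/
lemma abs_sub_le_of_tendsto
    (hderiv : ∀ k t, 0 ≤ t → HasDerivWithinAt (gs k) (As k t) (Set.Ici 0) t)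
    (hC : ∀ k t, 0 ≤ t → |As k t| ≤ C)
    (hg : ∀ t, 0 ≤ t → Tendsto (fun k => gs k t) atTop (𝓝 (g t)))
    {s t : ℝ} (hs : 0 ≤ s) (ht : 0 ≤ t) : |g t - g s| ≤ C * |t - s| := by
  refine le_of_tendsto ((hg t ht).sub (hg s hs)).abs (Eventually.of_forall fun k => ?_)
  exact (convex_Ici (0 : ℝ)).norm_image_sub_le_of_norm_hasDerivWithin_le
    (fun r hr => hderiv k r hr) (fun r hr => hC k r hr) hs ht

/-- A pointwise limit of functions with bounded, pointwise convergent derivatives is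
differentiable if the limit of the derivatives is continuous. -/
lemma hasDerivWithinAt_of_tendsto
    (hderiv : ∀ k t, 0 ≤ t → HasDerivWithinAt (gs k) (As k t) (Set.Ici 0) t)
    (hC : ∀ k t, 0 ≤ t → |As k t| ≤ C)
    (hg : ∀ t, 0 ≤ t → Tendsto (fun k => gs k t) atTop (𝓝 (g t)))
    (hA : ∀ t, 0 ≤ t → Tendsto (fun k => As k t) atTop (𝓝 (A t)))
    (hcont : ContinuousOn A (Set.Ici 0)) {t : ℝ} (ht : 0 ≤ t) :
    HasDerivWithinAt g (A t) (Set.Ici 0) t := by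
  -- No regularity of `As k` in time is assumed; its measurability comes from being a derivative.
  have hmeas : ∀ k b, AEStronglyMeasurable (As k) (volume.restrict (Set.Ioc 0 b)) := by
    intro k b
    refine (measurable_deriv (gs k)).aestronglyMeasurable.congr ?_
    filter_upwards [ae_restrict_mem measurableSet_Ioc] with r hr
    exact ((hderiv k r hr.1.le).hasDerivAt (Ici_mem_nhds hr.1)).deriv
  have hftc : ∀ k b, 0 ≤ b → ∫ r in (0 : ℝ)..b, As k r = gs k b - gs k 0 := by
    intro k b hb
    refine intervalIntegral.integral_eq_sub_of_hasDerivAt_of_le hb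
      (fun r hr => ((hderiv k r hr.1).continuousWithinAt).mono Set.Icc_subset_Ici_self)
      (fun r hr => (hderiv k r hr.1.le).hasDerivAt (Ici_mem_nhds hr.1)) ?_
    rw [intervalIntegrable_iff_integrableOn_Ioc_of_le hb]
    refine IntegrableOn.of_bound measure_Ioc_lt_top (hmeas k b) C ?_
    filter_upwards [ae_restrict_mem measurableSet_Ioc] with r hr using hC k r hr.1.le
  -- `A (max 0 r)` extends `A` continuously to the line, so the fundamental theorem of calculus also
  -- covers `t = 0`.
  have hint : ∀ b, 0 ≤ b → g b = g 0 + ∫ r in (0 : ℝ)..b, A (max 0 r) := by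
    intro b hb
    have h1 : Tendsto (fun k => ∫ r in (0 : ℝ)..b, As k r) atTop
        (𝓝 (∫ r in (0 : ℝ)..b, A (max 0 r))) := by
      refine intervalIntegral.tendsto_integral_filter_of_dominated_convergence (fun _ => C)
        (Eventually.of_forall fun k => ?_) (Eventually.of_forall fun k => ?_)
        intervalIntegrable_const ?_
      · rw [Set.uIoc_of_le hb]; exact hmeas k b
      · refine ae_of_all _ fun r hr => ?_
        rw [Set.uIoc_of_le hb] at hr
        exact hC k r hr.1.le
      · refine ae_of_all _ fun r hr => ?_
        rw [Set.uIoc_of_le hb] at hr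
        rw [max_eq_right hr.1.le]
        exact hA r hr.1.le
    have h2 := (hg b hb).sub (hg 0 le_rfl)
    simp only [hftc _ b hb] at h1
    linarith [tendsto_nhds_unique h1 h2]
  have hcont' : Continuous fun r => A (max 0 r) :=
    hcont.comp_continuous (by fun_prop) fun r => le_max_left 0 r
  have hd : HasDerivAt (fun b => ∫ r in (0 : ℝ)..b, A (max 0 r)) (A (max 0 t)) t :=
    intervalIntegral.integral_hasDerivAt_right (hcont'.intervalIntegrable _ _)
      (hcont'.stronglyMeasurableAtFilter _ _) hcont'.continuousAt
  have hd' := (hd.const_add (g 0)).hasDerivWithinAt (s := Set.Ici 0)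
  rw [max_eq_right ht] at hd'
  exact hd'.congr (fun b hb => hint b hb) (hint t ht)

end Time

section Nonneg

variable {E : Type*} [NormedAddCommGroup E] [NormedSpace ℝ E] [FiniteDimensional ℝ E]
  [MeasurableSpace E] [BorelSpace E] {μ : Measure E} [μ.IsAddHaarMeasure]

/-- Mollifications of `f` are nonnegative by hypothesis and converge to `f` almost everywhere by
Lebesgue differentiation. -/
lemma ae_nonneg_of_forall_integral_mul_nonneg {f : E → ℝ} (hf : LocallyIntegrable f μ)
    (h : ∀ ψ : E → ℝ, Continuous ψ → HasCompactSupport ψ → (∀ x, 0 ≤ ψ x) →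
      0 ≤ ∫ x, f x * ψ x ∂μ) : ∀ᵐ x ∂μ, 0 ≤ f x := by
  -- The ratio of the two radii stays equal to `2`, as the differentiation theorem asks for a
  -- bounded ratio.
  let φ : ℕ → ContDiffBump (0 : E) := fun k =>
    ⟨1 / (k + 1), 2 / (k + 1), by positivity, by gcongr; norm_num⟩
  have hφ : Tendsto (fun k => (φ k).rOut) atTop (𝓝 0) := by
    have := (tendsto_one_div_add_atTop_nhds_zero_nat (𝕜 := ℝ)).const_mul 2
    rw [mul_zero] at this
    exact this.congr fun k => by simp only [φ]; ring
  filter_upwards [ContDiffBump.ae_convolution_tendsto_right_of_locallyIntegrable (K := 2) hφ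
    (Eventually.of_forall fun k => by simp only [φ]; exact le_of_eq (by ring)) hf] with x hx
  refine ge_of_tendsto' hx fun k => ?_
  rw [convolution_eq_swap]
  have := h (fun t => (φ k).normed μ (x - t))
    ((φ k).continuous_normed.comp (continuous_const.sub continuous_id))
    ((φ k).hasCompactSupport_normed.comp_homeomorph (Homeomorph.subLeft x))
    fun t => (φ k).nonneg_normed _
  simpa [mul_comm] using this

end Nonneg

end ChooseLeader

namespace ChooseLeader

/-! ### The transport term -/

section Transport

variable {n : ℕ}

/-- As a total derivative in the direction `(v, 0)`, `transport` inherits smoothness and compact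
support. -/
lemma transport_eq_fderiv {φ : Phase n → ℝ} {z : Phase n} (hφ : DifferentiableAt ℝ φ z) :
    transport φ z = fderiv ℝ φ z (z.2, 0) := by
  have h1 : HasFDerivAt (fun y : Space n => (y, z.2))
      (ContinuousLinearMap.inl ℝ (Space n) (Space n)) z.1 := by
    exact hasFDerivAt_prodMk_left z.1 z.2
  have h2 : HasFDerivAt φ (fderiv ℝ φ z) (z.1, z.2) := hφ.hasFDerivAt
  have h3 := (h2.comp z.1 h1).fderiv
  rw [transport]
  change fderiv ℝ (φ ∘ fun y : Space n => (y, z.2)) z.1 z.2 = _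
  rw [h3]
  simp

lemma continuous_transport {φ : Phase n → ℝ} (hφ : ContDiff ℝ 1 φ) : Continuous (transport φ) := by
  have : transport φ = fun z => fderiv ℝ φ z (z.2, 0) :=
    funext fun z => transport_eq_fderiv (hφ.differentiable one_ne_zero z)
  rw [this]
  exact (hφ.continuous_fderiv one_ne_zero).clm_apply (by fun_prop)

lemma contDiff_transport {φ : Phase n → ℝ} (hφ : ContDiff ℝ ∞ φ) :
    ContDiff ℝ ∞ (transport φ) := by
  have : transport φ = fun z => fderiv ℝ φ z (z.2, 0) :=
    funext fun z => transport_eq_fderiv (hφ.differentiable (by simp) z)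
  rw [this]
  exact (hφ.fderiv_right (m := ∞) (by simp)).clm_apply (by fun_prop)

lemma hasCompactSupport_transport {φ : Phase n → ℝ} (hφ : Differentiable ℝ φ)
    (hs : HasCompactSupport φ) : HasCompactSupport (transport φ) := by
  refine hs.mono' fun z hz => ?_
  refine support_fderiv_subset ℝ (f := φ) fun h => hz ?_
  rw [transport_eq_fderiv (hφ z), h]
  rfl

lemma exists_bound {φ : Phase n → ℝ} (hφ : Continuous φ) (hs : HasCompactSupport φ) :
    ∃ B, ∀ z, |φ z| ≤ B := hs.exists_bound_of_continuous hφ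

end Transport

/-! ### The master equation in a chaotic state -/

section Master

variable {n M : ℕ}

lemma integral_pi_apply_zero (ν : ProbabilityMeasure (Phase n)) {h : Phase n → ℝ}
    (hh : Continuous h) :
    ∫ Z, h (Z 0) ∂(Measure.pi fun _ : Fin (M + 1) => (ν : Measure (Phase n))) =
      ∫ z, h z ∂(ν : Measure (Phase n)) :=
  integral_comp_eval (μ := fun _ : Fin (M + 1) => (ν : Measure (Phase n)))
    hh.aestronglyMeasurable

lemma transportAt_comp_apply_zero (φ : Phase n → ℝ) (i : Fin (M + 1)) (Z : Fin (M + 1) → Phase n) :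
    transportAt i (fun Z => φ (Z 0)) Z = if i = 0 then transport φ (Z 0) else 0 := by
  split_ifs with h
  · subst h
    simp [transportAt, transport]
  · simp [transportAt, Function.update_of_ne (Ne.symm h)]

lemma collide_apply_zero {i : Fin (M + 1)} (j : Fin (M + 1)) (Z : Fin (M + 1) → Phase n) :
    collide i j Z 0 = if i = 0 then ((Z 0).1, (Z j).2) else Z 0 := by
  split_ifs with h
  · subst h
    simp [collide]
  · simp [collide, Function.update_of_ne (Ne.symm h)]

/-- Only the follower `0` changes `Z 0`. Each of the other `M` followers contributes `φ (Z 0)`, as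
its leader probabilities sum to `1`. -/
lemma sum_leaderProb_collide {K : ℝ → ℝ} (hS : ∑ k ∈ Finset.Icc 1 M, K ((k : ℝ) / M) ≠ 0)
    {R : (Fin (M + 1) → Space n) → Fin (M + 1) → Fin (M + 1) → ℕ} (hR : ∀ x, IsRanking x (R x))
    (φ : Phase n → ℝ) (Z : Fin (M + 1) → Phase n) :
    ∑ i, ∑ j ∈ Finset.univ.erase i,
      leaderProb K M (R (fun l => (Z l).1) i j) * φ (collide i j Z 0) =
    leaderMean K φ R Z + M * φ (Z 0) := by
  rw [← Finset.add_sum_erase _ _ (Finset.mem_univ (0 : Fin (M + 1)))]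
  have h : ∀ i ∈ (Finset.univ : Finset (Fin (M + 1))).erase 0, ∑ j ∈ Finset.univ.erase i,
      leaderProb K M (R (fun l => (Z l).1) i j) * φ (collide i j Z 0) = φ (Z 0) := by
    intro i hi
    simp only [collide_apply_zero, if_neg (Finset.ne_of_mem_erase hi)]
    rw [← Finset.sum_mul, sum_leaderProb hS (hR _), one_mul]
  rw [Finset.sum_congr rfl h]
  simp [collide_apply_zero, leaderMean]

/-- The right-hand side of the master equation for a one-particle observable. -/
lemma master_rhs_eq (hn : 1 ≤ n) {F : (Fin (M + 1) → Phase n) → ℝ} (hF : IsProbDensity F)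
    (hc : IsChaotic F) {K : ℝ → ℝ} (hK : Continuous K) {A : ℝ} (hA : ∀ r, |K r| ≤ A)
    (hS : ∑ k ∈ Finset.Icc 1 M, K ((k : ℝ) / M) ≠ 0)
    {R : (Fin (M + 1) → Space n) → Fin (M + 1) → Fin (M + 1) → ℕ} (hR : ∀ x, IsRanking x (R x))
    {φ : Phase n → ℝ} (hφ : ContDiff ℝ ∞ φ) (hs : HasCompactSupport φ) :
    ((∑ i, ∫ Z, F Z * transportAt i (fun Z => φ (Z 0)) Z) +
        ((M : ℝ) + 1) * ∫ Z, (1 / ((M : ℝ) + 1) *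
            (∑ i, ∑ j ∈ Finset.univ.erase i,
              leaderProb K M (R (fun l => (Z l).1) i j) * φ (collide i j Z 0)) - φ (Z 0)) * F Z) =
      ∫ z, transport φ z ∂(hF.firstMarginal.law : Measure (Phase n)) +
        ∫ Z, leaderMean K φ R Z
          ∂(Measure.pi fun _ => (hF.firstMarginal.law : Measure (Phase n))) -
        ∫ z, φ z ∂(hF.firstMarginal.law : Measure (Phase n)) := by
  obtain ⟨B, hB⟩ := exists_bound hφ.continuous hs
  have hM : (M : ℝ) + 1 ≠ 0 := by positivity
  have h1 : ∑ i, ∫ Z, F Z * transportAt i (fun Z => φ (Z 0)) Z =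
      ∫ z, transport φ z ∂(hF.firstMarginal.law : Measure (Phase n)) := by
    rw [Finset.sum_eq_single_of_mem 0 (Finset.mem_univ _)]
    · simp only [transportAt_comp_apply_zero, if_true]
      rw [hc.integral_eq hF (fun Z => transport φ (Z 0)),
        integral_pi_apply_zero _ (continuous_transport (hφ.of_le (by simp)))]
    · intro i _ hi
      simp [transportAt_comp_apply_zero, hi]
  -- With `N = M + 1` and `L` the leader mean, `(L + M φ) / N - φ = (L - φ) / N`; the collision rate
  -- `N` then cancels the denominator.
  have h2 : ∀ Z : Fin (M + 1) → Phase n, (1 / ((M : ℝ) + 1) *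
            (∑ i, ∑ j ∈ Finset.univ.erase i,
              leaderProb K M (R (fun l => (Z l).1) i j) * φ (collide i j Z 0)) - φ (Z 0)) * F Z =
      F Z * (1 / ((M : ℝ) + 1) * (leaderMean K φ R Z - φ (Z 0))) := by
    intro Z
    rw [sum_leaderProb_collide hS hR]
    field_simp
    ring
  have hint : Integrable (fun Z : Fin (M + 1) → Phase n => φ (Z 0))
      (Measure.pi fun _ => (hF.firstMarginal.law : Measure (Phase n))) :=
    integrable_of_bounded _ (hφ.continuous.comp (continuous_apply 0)).aestronglyMeasurable
      fun Z => hB (Z 0)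
  simp only [h2]
  rw [h1, hc.integral_eq hF, integral_const_mul, integral_sub
    (integrable_leaderMean _ (hF.firstMarginal.nullSpheres_law hn) hK hA hφ.continuous hB hR) hint,
    integral_pi_apply_zero _ hφ.continuous]
  field_simp
  ring

end Master

/-! ### The weak limit equation -/

section Limit

variable {n : ℕ}

/-- An interaction profile, extended continuously to the line. -/
structure IsProfile (K : ℝ → ℝ) (A : ℝ) : Prop where
  uniformContinuous : UniformContinuous K
  nonneg : ∀ r, 0 ≤ K r
  abs_le : ∀ r, |K r| ≤ A
  integral_eq : ∫ r in (0 : ℝ)..1, K r = 1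

lemma tendsto_integral_leaderMean {K : ℝ → ℝ} {A : ℝ} (hK : IsProfile K A) {m : ℕ → ℕ}
    (hm : Tendsto m atTop atTop)
    {φ : Phase n → ℝ} (hφ : Continuous φ) {B : ℝ} (hB : ∀ z, |φ z| ≤ B)
    {R : ∀ M : ℕ, (Fin (M + 1) → Space n) → Fin (M + 1) → Fin (M + 1) → ℕ}
    (hR : ∀ M x, IsRanking x (R M x)) {νs : ℕ → ProbabilityMeasure (Phase n)}
    (hνs : ∀ k, NullSpheres (νs k)) {ν : ProbabilityMeasure (Phase n)} (hν : NullSpheres ν)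
    (hlim : Tendsto νs atTop (𝓝 ν)) :
    Tendsto (fun k => ∫ Z, leaderMean K φ (R (m k)) Z
      ∂(Measure.pi fun _ => (νs k : Measure (Phase n)))) atTop (𝓝 (meanGain K φ ν)) := by
  have hA0 : 0 ≤ A := (abs_nonneg _).trans (hK.abs_le 0)
  have hB0 : 0 ≤ B := (abs_nonneg _).trans (hB 0)
  have hKc := hK.uniformContinuous.continuous
  have hratio : Tendsto (fun k => (m k : ℝ) / ∑ i ∈ Finset.Icc 1 (m k), K ((i : ℝ) / m k)) atTop
      (𝓝 1) := by
    have := ((tendsto_riemann_sum hK.uniformContinuous).inv₀ (by rw [hK.integral_eq]; simp)).comp hm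
    rw [hK.integral_eq, inv_one] at this
    exact this.congr fun k => by simp [inv_div]
  have hmain : Tendsto (fun k => (m k : ℝ) / (∑ i ∈ Finset.Icc 1 (m k), K ((i : ℝ) / m k)) *
      meanGain K φ (νs k)) atTop (𝓝 (meanGain K φ ν)) := by
    have := hratio.mul (tendsto_meanGain hKc hK.abs_le hφ hB hlim hν)
    rwa [one_mul] at this
  have herr : Tendsto (fun k => ∫ Z, leaderMean K φ (R (m k)) Z
      ∂(Measure.pi fun _ => (νs k : Measure (Phase n))) -
      (m k : ℝ) / (∑ i ∈ Finset.Icc 1 (m k), K ((i : ℝ) / m k)) * meanGain K φ (νs k)) atTop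
      (𝓝 0) := by
    rw [Metric.tendsto_nhds]
    intro e he
    -- Once `M / S < 2` and the variance term is below `ε`, the error is at most `2 * B * 2ε < e`.
    set ε := e / (4 * (B + 1)) with hε
    have hε0 : 0 < ε := by positivity
    obtain ⟨δ, hδ, hKδ⟩ := Metric.uniformContinuous_iff.1 hK.uniformContinuous ε hε0
    have hdecay : Tendsto (fun k => 2 * A / (δ ^ 2 * m k)) atTop (𝓝 0) :=
      tendsto_const_nhds.div_atTop
        ((tendsto_natCast_atTop_atTop.comp hm).const_mul_atTop (by positivity))
    filter_upwards [hratio.eventually (gt_mem_nhds one_lt_two),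
      hratio.eventually (lt_mem_nhds zero_lt_one), hm.eventually (eventually_gt_atTop 0),
      hdecay.eventually (gt_mem_nhds hε0)] with k h2 h0 hmk hd
    have hmk' : (0 : ℝ) < m k := by exact_mod_cast hmk
    -- A sum `S ≤ 0` would make the ratio nonpositive, including `S = 0`, where division by zero
    -- gives `0`.
    have hS : 0 < ∑ i ∈ Finset.Icc 1 (m k), K ((i : ℝ) / m k) := by
      by_contra hneg
      exact absurd h0 (not_lt.2 (div_nonpos_of_nonneg_of_nonpos hmk'.le (not_lt.1 hneg)))
    have key := abs_integral_leader_sub_le (νs k) (hνs k) hKc hK.abs_le hε0.le hδ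
      (fun a b hab => (hKδ (by rwa [Real.dist_eq])).le) hmk hS hφ hB (hR (m k))
    rw [Real.dist_eq, sub_zero]
    refine key.trans_lt ?_
    have h3 : B * (ε + 2 * A / (δ ^ 2 * m k)) ≤ B * (2 * ε) :=
      mul_le_mul_of_nonneg_left (by linarith) hB0
    have h4 : B * (2 * ε) < e / 2 := by
      rw [hε, mul_div_assoc', mul_div_assoc', div_lt_div_iff₀ (by positivity) (by positivity)]
      nlinarith
    have h5 : 0 ≤ B * (ε + 2 * A / (δ ^ 2 * m k)) := by positivity
    nlinarith
  have := herr.add hmain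
  simpa using this

variable {m : ℕ → ℕ} {F : ∀ k : ℕ, ℝ → (Fin (m k + 1) → Phase n) → ℝ} {f : ℝ → Phase n → ℝ}

/-- Vague limits are nonnegative but may lose mass; testing the spatial densities against `1`
excludes this. -/
lemma isProbDensity_of_tendsto {fs : ℕ → Phase n → ℝ} {f : Phase n → ℝ}
    (hfs : ∀ k, IsProbDensity (fs k)) (hf : Integrable f)
    (hf_lim : ∀ ψ : Phase n → ℝ, Continuous ψ → HasCompactSupport ψ →
      Tendsto (fun k => ∫ z, fs k z * ψ z) atTop (𝓝 (∫ z, f z * ψ z)))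
    (hρ_lim : ∀ ψ : Space n → ℝ, Continuous ψ → (∃ C, ∀ x, |ψ x| ≤ C) →
      Tendsto (fun k => ∫ x, spatialDensity (fs k) x * ψ x) atTop
        (𝓝 (∫ x, spatialDensity f x * ψ x))) : IsProbDensity f := by
  refine ⟨?_, hf, ?_⟩
  · have : (volume : Measure (Phase n)).IsAddHaarMeasure :=
      inferInstanceAs ((volume : Measure (Space n)).prod volume).IsAddHaarMeasure
    refine ae_nonneg_of_forall_integral_mul_nonneg hf.locallyIntegrable fun ψ ψc ψs ψ0 => ?_
    refine ge_of_tendsto' (hf_lim ψ ψc ψs) fun k => integral_nonneg_of_ae ?_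
    filter_upwards [(hfs k).1] with z hz using mul_nonneg hz (ψ0 z)
  · have h1 := hρ_lim (fun _ => 1) continuous_const ⟨1, fun _ => by simp⟩
    simp only [mul_one, (hfs _).spatialDensity.2.2] at h1
    rw [tendsto_nhds_unique tendsto_const_nhds h1]
    exact integral_prod f hf

lemma hasDerivWithinAt_integral (hn : 1 ≤ n) {K : ℝ → ℝ} {A : ℝ} (hK : IsProfile K A)
    (hm : Tendsto m atTop atTop)
    (hS : ∀ k, 0 < ∑ i ∈ Finset.Icc 1 (m k), K ((i : ℝ) / m k))
    {R : ∀ M : ℕ, (Fin (M + 1) → Space n) → Fin (M + 1) → Fin (M + 1) → ℕ}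
    (hR : ∀ M x, IsRanking x (R M x))
    (hF : ∀ k t, 0 ≤ t → IsProbDensity (F k t))
    (hF_chaos : ∀ k t, 0 ≤ t → IsChaotic (F k t))
    (hF_master : ∀ k, ∀ φ : Phase n → ℝ, ContDiff ℝ ∞ φ → HasCompactSupport φ →
      MasterEquation K (R (m k)) (F k) (fun Z => φ (Z 0)))
    (hf : ∀ t, 0 ≤ t → IsProbDensity (f t))
    (hf_lim : ∀ t : ℝ, 0 ≤ t → ∀ ψ : Phase n → ℝ, Continuous ψ → HasCompactSupport ψ →
      Tendsto (fun k => ∫ z, firstMarginal (F k t) z * ψ z) atTop (𝓝 (∫ z, f t z * ψ z)))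
    {φ : Phase n → ℝ} (hφ : ContDiff ℝ ∞ φ) (hs : HasCompactSupport φ) {t : ℝ} (ht : 0 ≤ t) :
    HasDerivWithinAt (fun s => ∫ z, f s z * φ z)
        ((∫ z, f t z * transport φ z) + (∫ w, gainIntegrand K (f t) φ w) - ∫ z, f t z * φ z)
        (Set.Ici 0) t := by
  have hKc := hK.uniformContinuous.continuous
  -- the equation before the limit
  have hderiv : ∀ φ : Phase n → ℝ, ContDiff ℝ ∞ φ → HasCompactSupport φ → ∀ k t, ∀ ht : 0 ≤ t,
      HasDerivWithinAt (fun s => ∫ Z, F k s Z * φ (Z 0))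
        (∫ z, transport φ z ∂((hF k t ht).firstMarginal.law : Measure (Phase n)) +
          ∫ Z, leaderMean K φ (R (m k)) Z
            ∂(Measure.pi fun _ => ((hF k t ht).firstMarginal.law : Measure (Phase n))) -
          ∫ z, φ z ∂((hF k t ht).firstMarginal.law : Measure (Phase n))) (Set.Ici 0) t := by
    intro φ hφ hs k t ht
    rw [← master_rhs_eq hn (hF k t ht) (hF_chaos k t ht) hKc hK.abs_le (hS k).ne' (hR (m k)) hφ hs]
    exact hF_master k φ hφ hs t ht
  have hobs : ∀ φ : Phase n → ℝ, Continuous φ → ∀ k t, ∀ ht : 0 ≤ t,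
      ∫ Z, F k t Z * φ (Z 0) = ∫ z, φ z ∂((hF k t ht).firstMarginal.law : Measure (Phase n)) := by
    intro φ hφ k t ht
    rw [(hF_chaos k t ht).integral_eq (hF k t ht) (fun Z => φ (Z 0)),
      integral_pi_apply_zero _ hφ]
  have hobs_lim : ∀ φ : Phase n → ℝ, ContDiff ℝ ∞ φ → HasCompactSupport φ → ∀ t, 0 ≤ t →
      Tendsto (fun k => ∫ Z, F k t Z * φ (Z 0)) atTop (𝓝 (∫ z, f t z * φ z)) := by
    intro φ hφ hs t ht
    simp only [hobs φ hφ.continuous _ t ht, IsProbDensity.integral_law]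
    exact hf_lim t ht φ hφ.continuous hs
  have hlaw : ∀ t, ∀ ht : 0 ≤ t, Tendsto (fun k => (hF k t ht).firstMarginal.law) atTop
      (𝓝 (hf t ht).law) := by
    intro t ht
    refine tendsto_of_forall_integral_contDiff fun φ hφ hs => ?_
    simp only [IsProbDensity.integral_law]
    exact hf_lim t ht φ hφ.continuous hs
  -- Uniform in both `k` and `t`: this yields equicontinuity in time and domination of the
  -- derivatives.
  have hbound : ∀ φ : Phase n → ℝ, ContDiff ℝ ∞ φ → HasCompactSupport φ → ∃ C, ∀ k t, ∀ ht : 0 ≤ t,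
      |∫ z, transport φ z ∂((hF k t ht).firstMarginal.law : Measure (Phase n)) +
          ∫ Z, leaderMean K φ (R (m k)) Z
            ∂(Measure.pi fun _ => ((hF k t ht).firstMarginal.law : Measure (Phase n))) -
          ∫ z, φ z ∂((hF k t ht).firstMarginal.law : Measure (Phase n))| ≤ C := by
    intro φ hφ hs
    obtain ⟨B, hB⟩ := exists_bound hφ.continuous hs
    obtain ⟨T, hT⟩ := exists_bound (contDiff_transport hφ).continuous
      (hasCompactSupport_transport (hφ.differentiable (by simp)) hs)
    refine ⟨T + B + B, fun k t ht => ?_⟩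
    have b1 := norm_integral_le_of_norm_le_const
      (μ := ((hF k t ht).firstMarginal.law : Measure (Phase n))) (f := transport φ) (ae_of_all _ hT)
    have b2 := norm_integral_le_of_norm_le_const
      (μ := (Measure.pi fun _ => ((hF k t ht).firstMarginal.law : Measure (Phase n))))
      (f := leaderMean K φ (R (m k)))
      (ae_of_all _ (abs_leaderMean_le hK.nonneg (hS k) hB (hR (m k))))
    have b3 := norm_integral_le_of_norm_le_const
      (μ := ((hF k t ht).firstMarginal.law : Measure (Phase n))) (f := φ) (ae_of_all _ hB)
    simp only [probReal_univ, mul_one, Real.norm_eq_abs] at b1 b2 b3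
    exact (abs_sub _ _).trans (add_le_add ((abs_add_le _ _).trans (add_le_add b1 b2)) b3)
  -- continuity in time of the limit law
  have hcont_law : Continuous fun s : Set.Ici (0 : ℝ) => (hf s s.2).law := by
    rw [continuous_iff_continuousAt]
    intro s
    refine tendsto_of_forall_integral_contDiff fun φ hφ hs => ?_
    simp only [IsProbDensity.integral_law]
    obtain ⟨C, hC⟩ := hbound φ hφ hs
    have hlip : ∀ r : Set.Ici (0 : ℝ),
        |(∫ z, f r z * φ z) - ∫ z, f s z * φ z| ≤ C * |(r : ℝ) - s| :=
      fun r => abs_sub_le_of_tendsto (g := fun r => ∫ z, f r z * φ z)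
        (gs := fun k r => ∫ Z, F k r Z * φ (Z 0))
        -- The laws exist only for `t ≥ 0`; the value `0` at negative times is never used.
        (As := fun k t => if ht : 0 ≤ t then
          ∫ z, transport φ z ∂((hF k t ht).firstMarginal.law : Measure (Phase n)) +
          ∫ Z, leaderMean K φ (R (m k)) Z
            ∂(Measure.pi fun _ => ((hF k t ht).firstMarginal.law : Measure (Phase n))) -
          ∫ z, φ z ∂((hF k t ht).firstMarginal.law : Measure (Phase n)) else 0)
        (fun k t ht => by rw [dif_pos ht]; exact hderiv φ hφ hs k t ht)
        (fun k t ht => by rw [dif_pos ht]; exact hC k t ht) (hobs_lim φ hφ hs) s.2 r.2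
    rw [tendsto_iff_dist_tendsto_zero]
    refine squeeze_zero (fun _ => dist_nonneg) hlip ?_
    have : Tendsto (fun r : Set.Ici (0 : ℝ) => C * |(r : ℝ) - s|) (𝓝 s)
        (𝓝 (C * |(s : ℝ) - s|)) := Continuous.tendsto (by fun_prop) s
    simpa using this
  obtain ⟨B, hB⟩ := exists_bound hφ.continuous hs
  have hTs := hasCompactSupport_transport (hφ.differentiable (by simp)) hs
  have hTc := (contDiff_transport hφ).continuous
  obtain ⟨C, hC⟩ := hbound φ hφ hs
  have hweak : ∀ {ψ : Phase n → ℝ}, Continuous ψ → HasCompactSupport ψ → ∀ {ι : Type} {l : Filter ι}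
      {νs : ι → ProbabilityMeasure (Phase n)} {ν : ProbabilityMeasure (Phase n)},
      Tendsto νs l (𝓝 ν) → Tendsto (fun i => ∫ z, ψ z ∂(νs i : Measure (Phase n))) l
        (𝓝 (∫ z, ψ z ∂(ν : Measure (Phase n)))) := by
    intro ψ ψc ψs ι l νs ν h
    obtain ⟨D, hD⟩ := exists_bound ψc ψs
    exact (ProbabilityMeasure.tendsto_iff_forall_integral_tendsto.1 h)
      (BoundedContinuousFunction.ofNormedAddCommGroup ψ ψc D hD)
  -- Written through the law alone, the right-hand side is a functional whose weak continuity is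
  -- known.
  have hrhs : ∀ t, ∀ ht : 0 ≤ t,
      (∫ z, f t z * transport φ z) + (∫ w, gainIntegrand K (f t) φ w) - ∫ z, f t z * φ z =
      ∫ z, transport φ z ∂((hf t ht).law : Measure (Phase n)) + meanGain K φ (hf t ht).law -
        ∫ z, φ z ∂((hf t ht).law : Measure (Phase n)) := by
    intro t ht
    rw [(hf t ht).integral_law, (hf t ht).integral_law,
      (hf t ht).integral_gainIntegrand hKc hφ.continuous]
  refine hasDerivWithinAt_of_tendsto (gs := fun k r => ∫ Z, F k r Z * φ (Z 0)) (C := C)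
    (A := fun t => (∫ z, f t z * transport φ z) + (∫ w, gainIntegrand K (f t) φ w) -
      ∫ z, f t z * φ z)
    (As := fun k t => if ht : 0 ≤ t then
      ∫ z, transport φ z ∂((hF k t ht).firstMarginal.law : Measure (Phase n)) +
        ∫ Z, leaderMean K φ (R (m k)) Z
          ∂(Measure.pi fun _ => ((hF k t ht).firstMarginal.law : Measure (Phase n))) -
        ∫ z, φ z ∂((hF k t ht).firstMarginal.law : Measure (Phase n)) else 0)
    (fun k t ht => by rw [dif_pos ht]; exact hderiv φ hφ hs k t ht)
    (fun k t ht => by rw [dif_pos ht]; exact hC k t ht) (hobs_lim φ hφ hs) ?_ ?_ ht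
  · intro t ht
    simp only [dif_pos ht]
    rw [hrhs t ht]
    exact ((hweak hTc hTs (hlaw t ht)).add (tendsto_integral_leaderMean hK hm hφ.continuous hB hR
      (fun k => (hF k t ht).firstMarginal.nullSpheres_law hn) ((hf t ht).nullSpheres_law hn)
      (hlaw t ht))).sub (hweak hφ.continuous hs (hlaw t ht))
  · rw [continuousOn_iff_continuous_domRestrict, continuous_iff_continuousAt]
    intro s
    have hlim := hcont_law.tendsto s
    have := ((hweak hTc hTs hlim).add (tendsto_meanGain hKc hK.abs_le hφ.continuous hB hlim
      ((hf s s.2).nullSpheres_law hn))).sub (hweak hφ.continuous hs hlim)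
    rw [← hrhs s s.2] at this
    exact this.congr fun r => (hrhs r r.2).symm

end Limit

end ChooseLeader

namespace ChooseLeader

/-! ### The strong limit equation -/

section Strong

variable {n : ℕ}

/-- Integration by parts for the transport term. -/
lemma integral_mul_transport {f φ : Phase n → ℝ} (hf : ContDiff ℝ 1 f) (hφ : ContDiff ℝ 1 φ)
    (hs : HasCompactSupport φ) :
    ∫ z, f z * transport φ z = -∫ z, transport f z * φ z := by
  have hTs := hasCompactSupport_transport (hφ.differentiable one_ne_zero) hs
  have hi1 : Integrable (fun z => f z * transport φ z) :=
    (hf.continuous.mul (continuous_transport hφ)).integrable_of_hasCompactSupport hTs.mul_left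
  have hi2 : Integrable (fun z => transport f z * φ z) :=
    ((continuous_transport hf).mul hφ.continuous).integrable_of_hasCompactSupport hs.mul_left
  have hsec : ∀ {g : Phase n → ℝ}, HasCompactSupport g → ∀ v : Space n,
      HasCompactSupport fun x => g (x, v) := by
    intro g hg v
    refine HasCompactSupport.intro (hg.isCompact.image continuous_fst) fun x hx => ?_
    by_contra hne
    exact hx ⟨(x, v), subset_tsupport g hne, rfl⟩
  have hpair : ∀ v : Space n, Continuous fun x : Space n => (x, v) := fun v => by fun_prop
  have e1 := integral_prod_symm _ hi1
  have e2 := integral_prod_symm _ hi2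
  refine e1.trans (Eq.trans ?_ (congrArg Neg.neg e2).symm)
  rw [← integral_neg]
  congr 1
  funext v
  have hpd : ContDiff ℝ 1 fun x : Space n => (x, v) := by fun_prop
  -- For frozen `v`, transport is the derivative in the constant direction `v`, and the compact
  -- support of `φ` removes boundary terms.
  exact integral_mul_fderiv_eq_neg_fderiv_mul_of_integrable
    (f := fun x => f (x, v)) (g := fun x => φ (x, v)) (v := v)
    ((((continuous_transport hf).mul hφ.continuous).comp (hpair v)).integrable_of_hasCompactSupport
      (hsec hs v).mul_left)
    (((hf.continuous.mul (continuous_transport hφ)).comp (hpair v)).integrable_of_hasCompactSupport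
      (hsec hTs v).mul_left)
    (((hf.continuous.mul hφ.continuous).comp (hpair v)).integrable_of_hasCompactSupport
      (hsec hs v).mul_left)
    (fun x _ => (hf.comp hpd).differentiable one_ne_zero x)
    (fun x _ => (hφ.comp hpd).differentiable one_ne_zero x)

/-- It sends `((x₁, v₂), x₂)` to `(x₁, (x₂, v₂))`, so that integrating out `x₂` last turns the weak
gain integrand into `gain`. -/
lemma measurePreserving_regroup :
    MeasurePreserving fun p : Phase n × Space n => (p.1.1, (p.2, p.1.2)) := by
  have h1 : MeasurePreserving (MeasurableEquiv.prodAssoc : (Space n × Space n) × Space n ≃ᵐ _)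
      volume volume := volume_preserving_prodAssoc
  have h2 : MeasurePreserving (Prod.map id Prod.swap : Space n × Space n × Space n → _)
      volume volume := (MeasurePreserving.id volume).prod Measure.measurePreserving_swap
  exact h2.comp h1

variable {K : ℝ → ℝ} {A : ℝ} {f : Phase n → ℝ}

lemma IsProbDensity.integrable_gain (hf : IsProbDensity f) (hK : IsProfile K A) :
    Integrable (gain K f) := by
  -- For `φ = 1`, integrating the weak integrand over `x₂` gives exactly `gain`, so Fubini yields
  -- integrability.
  have h := hf.integrable_gainIntegrand hK.uniformContinuous.continuous hK.abs_le
    (φ := fun _ => 1) continuous_const (B := 1) fun _ => by simp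
  have h' := (measurePreserving_regroup.integrable_comp h.aestronglyMeasurable).2 h
  refine (Integrable.integral_prod_left h').congr (ae_of_all _ fun z => ?_)
  simp only [gain, gainIntegrand, Function.comp_def, ← integral_const_mul]
  congr 1
  funext x
  ring

lemma IsProbDensity.integral_gainIntegrand_eq (hf : IsProbDensity f) (hK : IsProfile K A)
    {φ : Phase n → ℝ} (hφ : Continuous φ) {B : ℝ} (hB : ∀ z, |φ z| ≤ B) :
    ∫ w, gainIntegrand K f φ w = ∫ z, φ z * gain K f z := by
  have h := hf.integrable_gainIntegrand hK.uniformContinuous.continuous hK.abs_le hφ hB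
  have h' := (measurePreserving_regroup.integrable_comp h.aestronglyMeasurable).2 h
  have e1 : ∫ w, gainIntegrand K f φ w =
      ∫ p : Phase n × Space n, gainIntegrand K f φ (p.1.1, (p.2, p.1.2)) := by
    rw [← integral_map measurePreserving_regroup.aemeasurable
      (by rw [measurePreserving_regroup.map_eq]; exact h.aestronglyMeasurable),
      measurePreserving_regroup.map_eq]
  rw [e1]
  refine (integral_prod _ h').trans ?_
  congr 1
  funext z
  simp only [gain, gainIntegrand, Function.comp_def, ← integral_const_mul]
  congr 1
  funext x
  ring

variable {f : ℝ → Phase n → ℝ}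

/-- A weak solution which is continuously differentiable is a strong solution. -/
lemma ae_strong_of_weak (hK : IsProfile K A) (hf : ∀ t, 0 ≤ t → IsProbDensity (f t))
    (hweak : ∀ φ : Phase n → ℝ, ContDiff ℝ ∞ φ → HasCompactSupport φ → ∀ t : ℝ, 0 ≤ t →
      HasDerivWithinAt (fun s => ∫ z, f s z * φ z)
        ((∫ z, f t z * transport φ z) + (∫ w, gainIntegrand K (f t) φ w) - ∫ z, f t z * φ z)
        (Set.Ici 0) t)
    (hreg : ContDiffOn ℝ 1 (fun p : ℝ × Phase n => f p.1 p.2) (Set.Ioi 0 ×ˢ Set.univ))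
    {t : ℝ} (ht : 0 < t) :
    ∀ᵐ z : Phase n, deriv (fun s => f s z) t + transport (f t) z = gain K (f t) z - f t z := by
  set G : ℝ × Phase n → ℝ := fun p => f p.1 p.2 with hG
  set D : ℝ → Phase n → ℝ := fun s z => fderiv ℝ G (s, z) (1, 0) with hD
  have hopen : IsOpen (Set.Ioi (0 : ℝ) ×ˢ (Set.univ : Set (Phase n))) := isOpen_Ioi.prod isOpen_univ
  have hderiv : ∀ s, 0 < s → ∀ z, HasDerivAt (fun r => f r z) (D s z) s := by
    intro s hs z
    have h1 : HasFDerivAt G (fderiv ℝ G (s, z)) (s, z) :=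
      ((hreg.contDiffAt (hopen.mem_nhds (Set.mk_mem_prod hs (Set.mem_univ z)))).differentiableAt
        one_ne_zero).hasFDerivAt
    have h2 : HasDerivAt (fun r : ℝ => (r, z)) ((1 : ℝ), (0 : Phase n)) s :=
      (hasDerivAt_id s).prodMk (hasDerivAt_const s z)
    exact h1.comp_hasDerivAt s h2
  have hDcont : ContinuousOn (fun p : ℝ × Phase n => D p.1 p.2)
      (Set.Ioi (0 : ℝ) ×ˢ (Set.univ : Set (Phase n))) :=
    (hreg.continuousOn_fderiv_of_isOpen hopen le_rfl).clm_apply continuousOn_const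
  have hfC : ∀ s, 0 < s → ContDiff ℝ 1 (f s) := by
    intro s hs
    have : ContDiff ℝ 1 fun z : Phase n => (s, z) := by fun_prop
    rw [← contDiffOn_univ]
    exact hreg.comp this.contDiffOn fun z _ => ⟨hs, Set.mem_univ _⟩
  have hDt : Continuous (D t) := by
    have : Continuous fun z : Phase n => (t, z) := by fun_prop
    exact hDcont.comp_continuous this fun z => ⟨ht, Set.mem_univ _⟩
  have hTt := continuous_transport (hfC t ht)
  have hgain := (hf t ht.le).integrable_gain hK
  have hdiff : ∀ φ : Phase n → ℝ, ContDiff ℝ ∞ φ → HasCompactSupport φ →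
      HasDerivAt (fun s => ∫ z, f s z * φ z) (∫ z, D t z * φ z) t := by
    intro φ hφ hs
    -- The time derivative is continuous for positive times, hence bounded on this compact set; that
    -- dominates the differentiated integrand.
    have hcpt : IsCompact (Set.Icc (t / 2) (2 * t) ×ˢ tsupport φ) :=
      isCompact_Icc.prod hs.isCompact
    obtain ⟨C, hC⟩ := hcpt.exists_bound_of_continuousOn
      (hDcont.mono fun p hp => ⟨lt_of_lt_of_le (half_pos ht) hp.1.1, Set.mem_univ _⟩)
    refine (hasDerivAt_integral_of_dominated_loc_of_deriv_le (s := Set.Icc (t / 2) (2 * t))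
      (F := fun s z => f s z * φ z) (F' := fun s z => D s z * φ z) (bound := fun z => C * |φ z|)
      (Icc_mem_nhds (by linarith) (by linarith)) ?_ ?_ ?_ ?_ ?_ ?_).2
    · filter_upwards [Ioi_mem_nhds ht] with s hs
      exact ((hfC s hs).continuous.mul hφ.continuous).aestronglyMeasurable
    · exact ((hfC t ht).continuous.mul hφ.continuous).integrable_of_hasCompactSupport hs.mul_left
    · exact (hDt.mul hφ.continuous).aestronglyMeasurable
    · refine ae_of_all _ fun z s hsI => ?_
      rw [norm_mul, Real.norm_eq_abs (φ z)]
      by_cases hz : z ∈ tsupport φ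
      · exact mul_le_mul_of_nonneg_right (hC (s, z) ⟨hsI, hz⟩) (abs_nonneg _)
      · rw [image_eq_zero_of_notMem_tsupport hz]; simp
    · exact (hφ.continuous.abs.integrable_of_hasCompactSupport hs.abs).const_mul C
    · refine ae_of_all _ fun z s hsI => ?_
      exact (hderiv s (lt_of_lt_of_le (half_pos ht) hsI.1) z).mul_const (φ z)
  have hloc : LocallyIntegrable fun z => D t z + transport (f t) z - (gain K (f t) z - f t z) :=
    ((hDt.locallyIntegrable.add hTt.locallyIntegrable).sub
      (hgain.sub (hf t ht.le).2.1).locallyIntegrable)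
  have hzero := ae_eq_zero_of_integral_contDiff_smul_eq_zero hloc fun φ hφ hs => by
    obtain ⟨B, hB⟩ := exists_bound hφ.continuous hs
    -- As `t > 0`, the one-sided derivative is two-sided, and the two expressions for it must agree.
    have hu := (hdiff φ hφ hs).unique ((hweak φ hφ hs t ht.le).hasDerivAt (Ici_mem_nhds ht))
    rw [integral_mul_transport (hfC t ht) (hφ.of_le (by simp)) hs,
      (hf t ht.le).integral_gainIntegrand_eq hK hφ.continuous hB] at hu
    have i1 : Integrable fun z => D t z * φ z :=
      (hDt.mul hφ.continuous).integrable_of_hasCompactSupport hs.mul_left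
    have i2 : Integrable fun z => transport (f t) z * φ z :=
      (hTt.mul hφ.continuous).integrable_of_hasCompactSupport hs.mul_left
    have i3 : Integrable fun z => φ z * gain K (f t) z :=
      hgain.bdd_mul hφ.continuous.aestronglyMeasurable (ae_of_all _ hB)
    have i4 : Integrable fun z => f t z * φ z :=
      (hf t ht.le).2.1.mul_bdd hφ.continuous.aestronglyMeasurable (ae_of_all _ hB)
    have hexp : ∀ z, φ z • (D t z + transport (f t) z - (gain K (f t) z - f t z)) =
        (D t z * φ z + transport (f t) z * φ z) - (φ z * gain K (f t) z - f t z * φ z) := by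
      intro z
      rw [smul_eq_mul]
      ring
    simp only [hexp]
    have i12 : Integrable fun z => D t z * φ z + transport (f t) z * φ z := i1.add i2
    have i34 : Integrable fun z => φ z * gain K (f t) z - f t z * φ z := i3.sub i4
    rw [integral_sub i12 i34, integral_add i1 i2, integral_sub i3 i4, hu]
    ring
  filter_upwards [hzero] with z hz
  rw [(hderiv t ht z).deriv]
  linarith

end Strong

end ChooseLeader

namespace ChooseLeader

/-! ### Extension of the interaction profile -/

section Extension

variable {K : ℝ → ℝ}

/-- The interaction profile, extended by constants outside `[0, 1]`. -/
noncomputable def extendProfile (K : ℝ → ℝ) : ℝ → ℝ :=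
  Set.IccExtend (zero_le_one : (0 : ℝ) ≤ 1) ((Set.Icc (0 : ℝ) 1).domRestrict K)

lemma extendProfile_eq {r : ℝ} (hr : r ∈ Set.Icc (0 : ℝ) 1) : extendProfile K r = K r := by
  rw [extendProfile, Set.IccExtend_of_mem _ _ hr, Set.domRestrict_apply]

/-- Composing with the projection onto `[0, 1]` keeps sign, bound and uniform continuity, so the
analysis can use `K` on the whole line. -/
lemma exists_isProfile_extendProfile (hK : ContinuousOn K (Set.Icc 0 1))
    (hK0 : ∀ r ∈ Set.Icc (0 : ℝ) 1, 0 ≤ K r) (hK1 : ∫ r in (0 : ℝ)..1, K r = 1) :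
    ∃ A, IsProfile (extendProfile K) A := by
  obtain ⟨A, hA⟩ := isCompact_Icc.exists_bound_of_continuousOn hK
  have huc : UniformContinuous ((Set.Icc (0 : ℝ) 1).domRestrict K) :=
    CompactSpace.uniformContinuous_of_continuous hK.domRestrict
  refine ⟨A, huc.comp (LipschitzWith.projIcc zero_le_one).uniformContinuous,
    fun r => hK0 _ (Subtype.prop _), fun r => hA _ (Subtype.prop _), ?_⟩
  refine Eq.trans ?_ hK1
  refine intervalIntegral.integral_congr fun r hr => extendProfile_eq ?_
  rwa [Set.uIcc_of_le zero_le_one] at hr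

lemma natCast_div_mem_Icc {M k : ℕ} (hk : k ≤ M) : (k : ℝ) / M ∈ Set.Icc (0 : ℝ) 1 :=
  ⟨by positivity, div_le_one_of_le₀ (by exact_mod_cast hk) (by positivity)⟩

lemma leaderProb_extendProfile {M r : ℕ} (hr : r ≤ M) :
    leaderProb (extendProfile K) M r = leaderProb K M r := by
  rw [leaderProb, leaderProb, extendProfile_eq (natCast_div_mem_Icc hr),
    Finset.sum_congr rfl fun k hk => extendProfile_eq (natCast_div_mem_Icc (Finset.mem_Icc.1 hk).2)]

variable {n : ℕ}

/-- The convention `R i i = 0` extends the bound to the diagonal, so rewriting under the sum needs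
no condition `j ≠ i`. -/
lemma IsRanking.le {M : ℕ} {x : Fin (M + 1) → Space n} {R : Fin (M + 1) → Fin (M + 1) → ℕ}
    (hR : IsRanking x R) (i j : Fin (M + 1)) : R i j ≤ M := by
  by_cases h : j = i
  · rw [h, hR.self i]; exact Nat.zero_le _
  · exact ((hR.bijOn i).mapsTo h).2

lemma MasterEquation.extendProfile {M : ℕ}
    {R : (Fin (M + 1) → Space n) → Fin (M + 1) → Fin (M + 1) → ℕ} (hR : ∀ x, IsRanking x (R x))
    {F : ℝ → (Fin (M + 1) → Phase n) → ℝ} {Φ : (Fin (M + 1) → Phase n) → ℝ}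
    (h : MasterEquation K R F Φ) : MasterEquation (extendProfile K) R F Φ := by
  intro t ht
  simp only [leaderProb_extendProfile ((hR _).le _ _)]
  exact h t ht

lemma IsProbDensity.partialMass_mem_Icc {f : Phase n → ℝ} (hf : IsProbDensity f) (x : Space n)
    (s : ℝ) : partialMass (ChooseLeader.spatialDensity f) x s ∈ Set.Icc (0 : ℝ) 1 := by
  rw [← hf.ballMass_law]
  exact ⟨ballMass_nonneg _ _ _, ballMass_le_one _ _ _⟩

lemma IsProbDensity.gainIntegrand_extendProfile {f : Phase n → ℝ} (hf : IsProbDensity f)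
    (φ : Phase n → ℝ) : gainIntegrand (ChooseLeader.extendProfile K) f φ = gainIntegrand K f φ := by
  funext w
  rw [gainIntegrand, gainIntegrand, extendProfile_eq (hf.partialMass_mem_Icc _ _)]

lemma IsProbDensity.gain_extendProfile {f : Phase n → ℝ} (hf : IsProbDensity f) :
    gain (ChooseLeader.extendProfile K) f = gain K f := by
  funext z
  simp only [gain, extendProfile_eq (hf.partialMass_mem_Icc _ _)]

end Extension

end ChooseLeader

/-! ### The limit equation for the original profile -/

theorem theorem1 (n : ℕ) (hn : 1 ≤ n)
    -- the interaction profile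
    (K : ℝ → ℝ) (hK_cont : ContinuousOn K (Set.Icc 0 1))
    (hK_nonneg : ∀ r ∈ Set.Icc (0 : ℝ) 1, 0 ≤ K r) (hK_int : ∫ r in (0 : ℝ)..1, K r = 1)
    -- for each number `M + 1` of particles, any choice of the proximity rank
    (R : ∀ M : ℕ, (Fin (M + 1) → Space n) → Fin (M + 1) → Fin (M + 1) → ℕ)
    (hR : ∀ M x, IsRanking x (R M x))
    -- the `(M + 1)`-particle densities
    (F : ∀ M : ℕ, ℝ → (Fin (M + 1) → Phase n) → ℝ)
    (hF : ∀ᶠ M in atTop, ∀ t : ℝ, 0 ≤ t → IsProbDensity (F M t))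
    -- propagation of chaos
    (hF_chaos : ∀ᶠ M in atTop, ∀ t : ℝ, 0 ≤ t → IsChaotic (F M t))
    -- the master equation, for observables of one particle
    (hF_master : ∀ᶠ M in atTop, ∀ φ : Phase n → ℝ, ContDiff ℝ ∞ φ → HasCompactSupport φ →
      MasterEquation K (R M) (F M) (fun Z => φ (Z 0)))
    -- the limit of the first marginals and of their spatial densities
    (f : ℝ → Phase n → ℝ) (hf : ∀ t : ℝ, 0 ≤ t → Integrable (f t))
    (hf_lim : ∀ t : ℝ, 0 ≤ t → ∀ ψ : Phase n → ℝ, Continuous ψ → HasCompactSupport ψ →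
      Tendsto (fun M => ∫ z, firstMarginal (F M t) z * ψ z) atTop (𝓝 (∫ z, f t z * ψ z)))
    (hρ_lim : ∀ t : ℝ, 0 ≤ t → ∀ ψ : Space n → ℝ, Continuous ψ → (∃ C, ∀ x, |ψ x| ≤ C) →
      Tendsto (fun M => ∫ x, spatialDensity (firstMarginal (F M t)) x * ψ x) atTop
        (𝓝 (∫ x, spatialDensity (f t) x * ψ x))) :
    -- the limit equation in weak form
    (∀ φ : Phase n → ℝ, ContDiff ℝ ∞ φ → HasCompactSupport φ → ∀ t : ℝ, 0 ≤ t →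
      Integrable (gainIntegrand K (f t) φ) ∧
      HasDerivWithinAt (fun s => ∫ z, f s z * φ z)
        ((∫ z, f t z * transport φ z) + (∫ w, gainIntegrand K (f t) φ w) - ∫ z, f t z * φ z)
        (Set.Ici 0) t) ∧
    -- the limit equation in strong form, where `f` is continuously differentiable
    (ContDiffOn ℝ 1 (fun p : ℝ × Phase n => f p.1 p.2) (Set.Ioi 0 ×ˢ Set.univ) →
      ∀ t : ℝ, 0 < t → ∀ᵐ z : Phase n,
        deriv (fun s => f s z) t + transport (f t) z = gain K (f t) z - f t z) := by
  obtain ⟨A, hP⟩ := exists_isProfile_extendProfile hK_cont hK_nonneg hK_int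
  -- `K` may vanish at all sample points for small `M`; since the Riemann sums tend to `1`, this
  -- stops eventually.
  have hS : ∀ᶠ M : ℕ in atTop, 0 < ∑ i ∈ Finset.Icc 1 M, extendProfile K ((i : ℝ) / M) := by
    have h := tendsto_riemann_sum hP.uniformContinuous
    rw [hP.integral_eq] at h
    filter_upwards [h.eventually (lt_mem_nhds zero_lt_one)] with M hM
    by_contra hneg
    exact absurd hM
      (not_lt.2 (div_nonpos_of_nonpos_of_nonneg (not_lt.1 hneg) (Nat.cast_nonneg _)))
  -- Shifting the index by `M₀` makes every eventual hypothesis hold for all `k`.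
  obtain ⟨M₀, hM₀⟩ := eventually_atTop.1 (((hF.and hF_chaos).and hF_master).and hS)
  have hm : Tendsto (fun k => k + M₀) atTop atTop := tendsto_add_atTop_nat M₀
  have hge : ∀ k, M₀ ≤ k + M₀ := fun k => Nat.le_add_left _ _
  have hf_lim' : ∀ t : ℝ, 0 ≤ t → ∀ ψ : Phase n → ℝ, Continuous ψ → HasCompactSupport ψ →
      Tendsto (fun k => ∫ z, firstMarginal (F (k + M₀) t) z * ψ z) atTop
        (𝓝 (∫ z, f t z * ψ z)) := fun t ht ψ h1 h2 => (hf_lim t ht ψ h1 h2).comp hm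
  have hfP : ∀ t, 0 ≤ t → IsProbDensity (f t) := fun t ht =>
    isProbDensity_of_tendsto (fun k => ((hM₀ _ (hge k)).1.1.1 t ht).firstMarginal) (hf t ht)
      (hf_lim' t ht) fun ψ h1 h2 => (hρ_lim t ht ψ h1 h2).comp hm
  have hweak : ∀ φ : Phase n → ℝ, ContDiff ℝ ∞ φ → HasCompactSupport φ → ∀ t : ℝ, 0 ≤ t →
      HasDerivWithinAt (fun s => ∫ z, f s z * φ z)
        ((∫ z, f t z * transport φ z) + (∫ w, gainIntegrand (extendProfile K) (f t) φ w) -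
          ∫ z, f t z * φ z) (Set.Ici 0) t := fun φ hφ hs t ht =>
    hasDerivWithinAt_integral hn hP (F := fun k => F (k + M₀)) hm
      (fun k => (hM₀ _ (hge k)).2) hR
      (fun k => (hM₀ _ (hge k)).1.1.1) (fun k => (hM₀ _ (hge k)).1.1.2)
      (fun k φ hφ hs => ((hM₀ _ (hge k)).1.2 φ hφ hs).extendProfile (hR _)) hfP hf_lim' hφ hs ht
  refine ⟨fun φ hφ hs t ht => ?_, fun hreg t ht => ?_⟩
  · obtain ⟨B, hB⟩ := exists_bound hφ.continuous hs
    rw [← (hfP t ht).gainIntegrand_extendProfile]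
    exact ⟨(hfP t ht).integrable_gainIntegrand hP.uniformContinuous.continuous hP.abs_le
      hφ.continuous hB, hweak φ hφ hs t ht⟩
  · rw [← (hfP t ht.le).gain_extendProfile]
    exact ae_strong_of_weak hP hfP hweak hreg ht
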